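/- Let $N\ge 2$ and let $S_1,\dots,S_N$ be contractive similarities of $\mathbb R^d$ with scaling ratios $r_1,\dots,r_N\in(0,1)$. Let $O\subseteq\mathbb R^d$ be a nonempty open set with $S_n(O)\subseteq O$ for all $n$ and $S_n(O)\cap S_m(O)=\emptyset$ for $n\ne m$. The generators are the connected components of $O\setminus\bigcup_{n}S_n(\overline O)$; the self-similar tiling $\mathcal T$ is the set of all $S_w(G)$, where $G$ is a generator and $w=w_1\cdots w_k$ a finite (possibly empty) word over $\{1,\dots,N\}$, $S_w=S_{w_1}\circ\cdots\circ S_{w_k}$; put $r_w=r_{w_1}\cdots r_{w_k}$ and $T=\bigcup_{R\in\mathcal T}R$. For $A\subseteq\mathbb R^d$ let $V(A,\varepsilon)=\lambda_d(\{x\in A: \operatorname{dist}(x,A^c)\le\varepsilon\})$. Assume that there is exactly one generator $G$ and that it is bounded and monophase: with $g$ the inradius of $G$ (the maximal radius of a ball contained in $G$), there are constants $\kappa_0,\dots,\kappa_d\in\mathbb R$ with $V(G,\varepsilon)=\sum_{k=0}^{d}\kappa_k\varepsilon^{d-k}$ for $0<\varepsilon\le g$. Put $\Gamma_s(G)=\sum_{k=0}^{d-1}\frac{g^{s-k}}{s-k}(d-k)\kappa_k$.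 Let $D$ be the abscissa of convergence of the scaling zeta function $\zeta(s)=\sum_w r_w^{s}$ (the sum is over all finite words), and assume $d-1<D$. Call $\zeta$ lattice if there are $r>0$ and integers $k_1,\dots,k_N$ with $r_n=r^{k_n}$ for all $n$, and nonlattice otherwise. For $\alpha\in\mathbb R$ let $\mathcal M_\alpha(\mathcal T)=\lim_{\varepsilon\to0^+}\varepsilon^{-(d-\alpha)}V(T,\varepsilon)$ and $\overline{\mathcal M}_\alpha(\mathcal T)=\lim_{b\to\infty}\frac1{\log b}\int_{1/b}^1\varepsilon^{-(d-\alpha)}V(T,\varepsilon)\frac{d\varepsilon}{\varepsilon}$, whenever these limits exist in $[0,\infty]$. Let $\dim_M\mathcal T=\inf\{\alpha\ge0:\mathcal M_\alpha(\mathcal T)=0\}$, and call $\mathcal T$ Minkowski measurable if for some $\alpha\in[0,d]$ the limit $\mathcal M_\alpha(\mathcal T)$ exists and lies in $(0,\infty)$. Then $\dim_M\mathcal T=D$, and $\mathcal T$ is Minkowski measurable if and only if $\zeta$ is nonlattice. In the nonlattice case $$\mathcal M_D(\mathcal T)=\frac{\Gamma_D(G)}{(d-D)\sum_{n=1}^N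 r_n^D\log r_n^{-1}}\in(0,\infty).$$ In the lattice case $\mathcal M_D(\mathcal T)$ does not exist (in $[0,\infty]$), but $\overline{\mathcal M}_D(\mathcal T)$ exists and, whenever $r_n=r^{k_n}$ for all $n$ as above, $$\overline{\mathcal M}_D(\mathcal T)=\frac{\Gamma_D(G)}{(d-D)\sum_{n=1}^N r^{k_nD}\,k_n\log r^{-1}}\in(0,\infty).$$ -/

import Mathlib

open Filter Topology MeasureTheory
open scoped ENNReal

noncomputable section

namespace SelfSimilarTiling

/-- A system of `N` contractive similarities of `ℝᵈ`, the `n`-th one with scaling ratio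
`r n ∈ (0, 1)`. -/
structure IsSelfSimilarSystem {d N : ℕ}
    (S : Fin N → EuclideanSpace ℝ (Fin d) → EuclideanSpace ℝ (Fin d)) (r : Fin N → ℝ) :
    Prop where
  two_le : 2 ≤ N
  ratio_pos : ∀ n, 0 < r n
  ratio_lt_one : ∀ n, r n < 1
  dist_map : ∀ n x y, dist (S n x) (S n y) = r n * dist x y

/-- `O` is a feasible open set for the system (open set condition). -/
structure IsFeasible {d N : ℕ}
    (S : Fin N → EuclideanSpace ℝ (Fin d) → EuclideanSpace ℝ (Fin d))
    (O : Set (EuclideanSpace ℝ (Fin d))) : Prop where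
  isOpen : IsOpen O
  nonempty : O.Nonempty
  image_subset : ∀ n, S n '' O ⊆ O
  disjoint : ∀ n m, n ≠ m → Disjoint (S n '' O) (S m '' O)

/-- The map `S_w = S_{w₁} ∘ ⋯ ∘ S_{wₖ}` of a finite word `w`; the empty word gives the identity. -/
def wordMap {d N : ℕ}
    (S : Fin N → EuclideanSpace ℝ (Fin d) → EuclideanSpace ℝ (Fin d)) :
    List (Fin N) → EuclideanSpace ℝ (Fin d) → EuclideanSpace ℝ (Fin d)
  | [] => id
  | n :: w => S n ∘ wordMap S w

/-- The scaling ratio `r_w = r_{w₁} ⋯ r_{wₖ}` of a finite word `w`; it is `1` for the empty word. -/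
def wordRatio {N : ℕ} (r : Fin N → ℝ) (w : List (Fin N)) : ℝ := (w.map r).prod

/-- The generators: the connected components of `O \ ⋃ₙ Sₙ(closure O)`. -/
def generators {d N : ℕ}
    (S : Fin N → EuclideanSpace ℝ (Fin d) → EuclideanSpace ℝ (Fin d))
    (O : Set (EuclideanSpace ℝ (Fin d))) : Set (Set (EuclideanSpace ℝ (Fin d))) :=
  {C | ∃ x ∈ O \ ⋃ n, S n '' closure O,
    C = connectedComponentIn (O \ ⋃ n, S n '' closure O) x}

/-- The self-similar tiling: all images of generators under the maps of finite words. -/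
def tiling {d N : ℕ}
    (S : Fin N → EuclideanSpace ℝ (Fin d) → EuclideanSpace ℝ (Fin d))
    (O : Set (EuclideanSpace ℝ (Fin d))) : Set (Set (EuclideanSpace ℝ (Fin d))) :=
  {R | ∃ w : List (Fin N), ∃ G ∈ generators S O, R = wordMap S w '' G}

/-- The inner parallel volume `V(A, ε) = λ_d {x ∈ A | d(x, Aᶜ) ≤ ε}`, with values in `[0, ∞]`. -/
def innerVolume {d : ℕ} (A : Set (EuclideanSpace ℝ (Fin d))) (ε : ℝ) : ℝ≥0∞ :=
  volume {x | x ∈ A ∧ Metric.infDist x Aᶜ ≤ ε}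

/-- The inradius: the maximal radius of a ball contained in `A`. -/
def inradius {d : ℕ} (A : Set (EuclideanSpace ℝ (Fin d))) : ℝ :=
  sSup {ρ | 0 < ρ ∧ ∃ x, Metric.ball x ρ ⊆ A}

/-- `κ 0, …, κ d` are the coefficient functions of a Steiner-like representation of `V(G, ·)`
on `(0, g]`, where `g` is the inradius of the bounded open set `G`. The values `κ k` with `k > d`
play no role. -/
structure IsSteinerLike {d : ℕ} (G : Set (EuclideanSpace ℝ (Fin d))) (κ : ℕ → ℝ → ℝ) :
    Prop where
  isOpen : IsOpen G
  isBounded : Bornology.IsBounded G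
  bounded_coeff : ∀ k ≤ d, ∀ ε₀, 0 < ε₀ → ε₀ ≤ inradius G →
    ∃ C, ∀ ε, ε₀ ≤ ε → ε ≤ inradius G → |κ k ε| ≤ C
  volume_eq : ∀ ε, 0 < ε → ε ≤ inradius G →
    (innerVolume G ε).toReal = ∑ k ∈ Finset.range (d + 1), κ k ε * ε ^ (d - k)

/-- `G` is monophase, with the constants `κ 0, …, κ d` as coefficients: there is a Steiner-like
representation whose coefficients do not depend on `ε`. -/
def IsMonophaseWith {d : ℕ} (G : Set (EuclideanSpace ℝ (Fin d))) (κ : ℕ → ℝ) : Prop :=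
  IsSteinerLike G (fun k _ => κ k)

/-- `Γ_s(G) = ∑_{k < d} g^{s-k} / (s-k) * (d-k) * κ_k(G)`, for a real exponent `s`. -/
def Gam {d : ℕ} (G : Set (EuclideanSpace ℝ (Fin d))) (κ : ℕ → ℝ) (s : ℝ) : ℝ :=
  ∑ k ∈ Finset.range d, inradius G ^ (s - (k : ℝ)) / (s - (k : ℝ)) * ((d : ℝ) - (k : ℝ)) * κ k

/-- The abscissa of convergence of the scaling zeta function, that is, of the Dirichlet series
`∑_w r_w ^ s` over all finite words `w`. -/
def abscissa {N : ℕ} (r : Fin N → ℝ) : ℝ :=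
  sInf (Complex.re '' {s : ℂ | Summable fun w : List (Fin N) => (wordRatio r w : ℂ) ^ s})

/-- The lattice case: all scaling ratios are integer powers of one positive number. -/
def IsLattice {N : ℕ} (r : Fin N → ℝ) : Prop :=
  ∃ ρ : ℝ, 0 < ρ ∧ ∃ k : Fin N → ℤ, ∀ n, r n = ρ ^ k n

/-- The `α`-dimensional Minkowski content of `𝒯` exists in `[0, ∞]` and equals `L`. -/
def HasMinkowskiContent {d : ℕ} (𝒯 : Set (Set (EuclideanSpace ℝ (Fin d)))) (α : ℝ)
    (L : ℝ≥0∞) : Prop :=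
  Tendsto (fun ε : ℝ => ENNReal.ofReal (ε ^ (-((d : ℝ) - α))) * innerVolume (⋃₀ 𝒯) ε)
    (𝓝[>] 0) (𝓝 L)

/-- `𝒯` is Minkowski measurable: for some dimension `α ∈ [0, d]`, its `α`-dimensional Minkowski
content exists and is positive and finite. -/
def IsMinkowskiMeasurable {d : ℕ} (𝒯 : Set (Set (EuclideanSpace ℝ (Fin d)))) : Prop :=
  ∃ α : ℝ, 0 ≤ α ∧ α ≤ d ∧ ∃ L : ℝ≥0∞, 0 < L ∧ L < ∞ ∧ HasMinkowskiContent 𝒯 α L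

/-- The Minkowski dimension `inf {α ≥ 0 | M_α(𝒯) = 0}`. -/
def minkowskiDim {d : ℕ} (𝒯 : Set (Set (EuclideanSpace ℝ (Fin d)))) : ℝ :=
  sInf {α : ℝ | 0 ≤ α ∧ HasMinkowskiContent 𝒯 α 0}

/-- The `α`-dimensional average Minkowski content of `𝒯`, the limit as `b → ∞` of
`(1 / log b) ∫_{1/b}^1 ε^{-(d-α)} V(T, ε) dε/ε`, exists in `[0, ∞]` and equals `L`. -/
def HasAverageMinkowskiContent {d : ℕ} (𝒯 : Set (Set (EuclideanSpace ℝ (Fin d)))) (α : ℝ)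
    (L : ℝ≥0∞) : Prop :=
  Tendsto (fun b : ℝ =>
      (∫⁻ ε in Set.Ioc (1 / b) 1,
        ENNReal.ofReal (ε ^ (-((d : ℝ) - α)) / ε) * innerVolume (⋃₀ 𝒯) ε) /
      ENNReal.ofReal (Real.log b))
    atTop (𝓝 L)

end SelfSimilarTiling

end

/-!
In logarithmic coordinates `ε = e ^ (-t)` the scaled inner volume
`Z t = ε ^ (-(d - D)) V(T, ε)` of the union `T` of all tiles solves a renewal equation. The set `T`
is the disjoint union of the open sets `G, S₁ T, …, S_N T`, and a point of one of them is as far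
from the complement of that piece as from the complement of `T`
(`SelfSimilarTiling.infDist_compl_iUnion`), so that `V(T, ε) = V(G, ε) + ∑ rₙᵈ V(T, ε / rₙ)`. As
`D` solves the Moran equation `∑ rₙ ^ D = 1` (`SelfSimilarTiling.abscissa_spec`), the numbers
`rₙ ^ D` are the weights of a probability distribution on the steps `lₙ = log rₙ⁻¹`, and
`Z t = z t + ∑ rₙ ^ D Z (t - lₙ)` with a source `z` coming from the generator. For `ε ≥ g` the
volume `V(T, ε)` is constant; for `ε ≤ g` the source is a combination of the exponentials
`e ^ (-(D - k) t)` with `k < d`, all of them decaying since `d - 1 < D`. The term `k = d` is absent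
because `V(G, ε) → 0`. Comparing volumes gives `∑ rₙᵈ < 1`, that is, `D < d`.

The quantity `∑ rₙ ^ D ∫_{t - lₙ}^t Z` grows by the integral of `z`, so it converges to the total mass of the
source, which is `Γ_D(G) / (d - D)` (`SelfSimilarTiling.sourceMass_tiling`). This yields
boundedness of `Z`, and by integration the convergence of its averages to the asserted constant
(`Renewal.tendsto_average`), both in the lattice and in the nonlattice case. In the nonlattice case
the steps generate a dense subgroup of `ℝ`, and `Z` itself converges by Feller's argument
(`Renewal.tendsto_of_dense`): where `Z` is close to its upper limit, so it is at all translates by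
elements of the semigroup of the steps, hence on long intervals, and the conserved quantity bounds
the upper limit by the asserted constant; the lower limit is treated alike. In the lattice case,
convergence of `Z` would make the sums of the source over the cosets of the lattice constant; over
a short interval these sums are a combination of a growing exponential with positive coefficient and
decaying ones, and by analyticity such a combination is not constant
(`Renewal.IsExpSolution.not_tendsto_of_lattice`). The dimension and measurability statements follow
from boundedness of `Z` and the positive limit of its averages.
-/

namespace Renewal

/-! ### Semigroups of steps and weighted means -/

section Steps

variable {ι : Type*}

theorem exists_sub_of_mem_addSubgroupClosure {s : Set ℝ} {x : ℝ}
    (hx : x ∈ AddSubgroup.closure s) :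
    ∃ u ∈ AddSubmonoid.closure s, ∃ v ∈ AddSubmonoid.closure s, x = u - v := by
  induction hx using AddSubgroup.closure_induction with
  | mem x hx => exact ⟨x, AddSubmonoid.subset_closure hx, 0, zero_mem _, by simp⟩
  | zero => exact ⟨0, zero_mem _, 0, zero_mem _, by simp⟩
  | add x y _ _ hx hy =>
    obtain ⟨u, hu, v, hv, rfl⟩ := hx
    obtain ⟨u', hu', v', hv', rfl⟩ := hy
    exact ⟨u + u', add_mem hu hu', v + v', add_mem hv hv', by ring⟩
  | neg x _ hx =>
    obtain ⟨u, hu, v, hv, rfl⟩ := hx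
    exact ⟨v, hv, u, hu, by ring⟩

theorem nonneg_of_mem_addSubmonoidClosure {l : ι → ℝ} (hl : ∀ i, 0 < l i) {x : ℝ}
    (hx : x ∈ AddSubmonoid.closure (Set.range l)) : 0 ≤ x := by
  induction hx using AddSubmonoid.closure_induction with
  | mem x hx => obtain ⟨i, rfl⟩ := hx; exact (hl i).le
  | zero => exact le_rfl
  | add x y _ _ hx hy => exact add_nonneg hx hy

/-- If the steps `l i > 0` generate a dense subgroup of `ℝ`, the semigroup they generate becomes
arbitrarily fine far out. -/
theorem exists_forall_ge_exists_mem_closure [Nonempty ι] {l : ι → ℝ} (hl : ∀ i, 0 < l i)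
    (hd : Dense (AddSubgroup.closure (Set.range l) : Set ℝ)) {δ : ℝ} (hδ : 0 < δ) :
    ∃ M, ∀ t ≥ M, ∃ s ∈ AddSubmonoid.closure (Set.range l), s ≤ t ∧ t < s + δ := by
  obtain ⟨i⟩ := ‹Nonempty ι›
  obtain ⟨e, he, he0, heδ⟩ := hd.exists_between hδ
  obtain ⟨u, hu, v, hv, rfl⟩ := exists_sub_of_mem_addSubgroupClosure he
  -- Adding `l i` to both makes the subtrahend positive.
  set x := u + l i with hx
  set y := v + l i with hy
  have hli : l i ∈ AddSubmonoid.closure (Set.range l) :=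
    AddSubmonoid.subset_closure ⟨i, rfl⟩
  have hxm : x ∈ AddSubmonoid.closure (Set.range l) := add_mem hu hli
  have hym : y ∈ AddSubmonoid.closure (Set.range l) := add_mem hv hli
  have hy0 : 0 < y := by
    have := nonneg_of_mem_addSubmonoidClosure hl hv
    have := hl i
    linarith
  have hg : u - v = x - y := by rw [hx, hy]; ring
  rw [hg] at he0 heδ
  refine ⟨(⌈y / (x - y)⌉₊ : ℝ) * y, fun t ht => ?_⟩
  have ht0 : 0 ≤ t := le_trans (by positivity) ht
  set m := ⌊t / y⌋₊ with hm
  have hm1 : (m : ℝ) * y ≤ t := (le_div_iff₀ hy0).1 (Nat.floor_le (by positivity))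
  have hm2 : t < (m + 1) * y := (div_lt_iff₀ hy0).1 (Nat.lt_floor_add_one _)
  have hm3 : ⌈y / (x - y)⌉₊ ≤ m := Nat.le_floor ((le_div_iff₀ hy0).2 ht)
  set j := ⌊(t - m * y) / (x - y)⌋₊ with hj
  have hj1 : (j : ℝ) * (x - y) ≤ t - m * y :=
    (le_div_iff₀ he0).1 (Nat.floor_le (div_nonneg (by linarith) he0.le))
  have hj2 : t - m * y < (j + 1) * (x - y) := (div_lt_iff₀ he0).1 (Nat.lt_floor_add_one _)
  have hjm : j ≤ m := by
    refine le_trans ?_ hm3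
    rw [← Nat.cast_le (α := ℝ)]
    refine le_trans ?_ (Nat.le_ceil _)
    rw [le_div_iff₀ he0]
    linarith
  refine ⟨(m - j) • y + j • x, add_mem (nsmul_mem hym _) (nsmul_mem hxm _), ?_, ?_⟩ <;>
  · simp only [nsmul_eq_mul, Nat.cast_sub hjm]
    nlinarith

variable [Fintype ι]

/-- If a weighted mean of functions tends to `β` and none of them exceeds `β` asymptotically, then
each of them tends to `β`. -/
theorem tendsto_of_tendsto_sum {F : Filter ℝ} {p : ι → ℝ} (hp : ∀ i, 0 < p i)
    (hp1 : ∑ i, p i = 1) {u : ι → ℝ → ℝ} {β : ℝ}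
    (hs : Tendsto (fun t => ∑ i, p i * u i t) F (𝓝 β))
    (hle : ∀ η > 0, ∀ i, ∀ᶠ t in F, u i t ≤ β + η) (i : ι) : Tendsto (u i) F (𝓝 β) := by
  rw [tendsto_order]
  refine ⟨fun b hb => ?_, fun b hb => ?_⟩
  · set η := p i * (β - b) / 2 with hη
    have hη0 : 0 < η := by have := hp i; have := sub_pos.2 hb; positivity
    filter_upwards [(tendsto_order.1 hs).1 (β - η) (by linarith),
      eventually_all.2 (hle η hη0)] with t ht hu
    have h1 : p i * (β + η) - p i * u i t ≤ ∑ j, (p j * (β + η) - p j * u j t) :=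
      Finset.single_le_sum (f := fun j => p j * (β + η) - p j * u j t)
        (fun j _ => by rw [← mul_sub]; exact mul_nonneg (hp j).le (by linarith [hu j]))
        (Finset.mem_univ i)
    rw [Finset.sum_sub_distrib] at h1
    rw [← Finset.sum_mul, hp1] at h1
    have hpi := hp i
    by_contra! hcon
    nlinarith
  · filter_upwards [hle ((b - β) / 2) (by linarith) i] with t ht
    linarith

end Steps

/-! ### The renewal theorem for dense step groups -/

section Dense

variable {ι : Type*} [Fintype ι]

/-- Feller's argument: if an asymptotic solution `Z` of the renewal equation is asymptotically at
most `β` and tends to `β` along `F`, then so do all its translates by elements of the semigroup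
generated by the steps. -/
theorem tendsto_sub_of_mem_closure {F : Filter ℝ} (hF : F ≤ atTop) {p l : ι → ℝ}
    (hp : ∀ i, 0 < p i) (hp1 : ∑ i, p i = 1) {Z : ℝ → ℝ} {β : ℝ}
    (hZ : Tendsto (fun t => Z t - ∑ i, p i * Z (t - l i)) atTop (𝓝 0))
    (hle : ∀ η > 0, ∀ᶠ t in atTop, Z t ≤ β + η) (hβ : Tendsto Z F (𝓝 β)) {s : ℝ}
    (hs : s ∈ AddSubmonoid.closure (Set.range l)) :
    Tendsto (fun t => Z (t - s)) F (𝓝 β) := by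
  induction hs using AddSubmonoid.closure_induction_right with
  | zero => simpa using hβ
  | add_right x hx y hy ih =>
    obtain ⟨i, rfl⟩ := hy
    have hsub : ∀ c : ℝ, Tendsto (fun t => t - c) F atTop := fun c =>
      (tendsto_atTop_add_const_right _ (-c) tendsto_id).mono_left hF
    have h1 : Tendsto (fun t => ∑ i, p i * Z (t - x - l i)) F (𝓝 β) := by
      have := ih.sub (hZ.comp (hsub x))
      simpa using this
    have h2 := tendsto_of_tendsto_sum (u := fun i t => Z (t - x - l i)) hp hp1 h1
      (fun η hη j => by
        have := (hsub (x + l j)).eventually (hle η hη)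
        filter_upwards [this] with t ht
        rwa [sub_sub]) i
    simpa only [sub_sub] using h2

/-- The translates of `Z` along which it is close to its asymptotic upper bound `β` fill an
interval longer than every step, on which the conserved quantity is then almost `β ∑ pᵢ lᵢ`. The
offset `c` in the regularity assumption allows it to be applied to `-Z` as well. -/
theorem sum_mul_le_of_tendsto [Nonempty ι] {F : Filter ℝ} [F.NeBot] (hF : F ≤ atTop)
    {p l : ι → ℝ} (hp : ∀ i, 0 < p i) (hp1 : ∑ i, p i = 1) (hl : ∀ i, 0 < l i)
    (hd : Dense (AddSubgroup.closure (Set.range l) : Set ℝ)) {Z : ℝ → ℝ} {β A : ℝ}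
    (hZint : ∀ a b, IntervalIntegrable Z volume a b)
    (hZ : Tendsto (fun t => Z t - ∑ i, p i * Z (t - l i)) atTop (𝓝 0))
    (hA : Tendsto (fun t => ∑ i, p i * ∫ x in (t - l i)..t, Z x) atTop (𝓝 A))
    (hreg : ∀ η > 0, ∃ δ > 0, ∃ c, ∀ t, ∀ s ∈ Set.Icc c (c + δ), Z (t + s) ≤ Z t + η)
    (hle : ∀ η > 0, ∀ᶠ t in atTop, Z t ≤ β + η) (hβ : Tendsto Z F (𝓝 β)) :
    (∑ i, p i * l i) * β ≤ A := by
  have hμ : 0 < ∑ i, p i * l i :=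
    Finset.sum_pos (fun i _ => mul_pos (hp i) (hl i)) Finset.univ_nonempty
  suffices h : ∀ η > 0, (∑ i, p i * l i) * (β - 2 * η) ≤ A by
    refine le_of_forall_pos_le_add fun e he => ?_
    have := h (e / (2 * ∑ i, p i * l i)) (by positivity)
    field_simp at this
    linarith
  intro η hη
  obtain ⟨δ, hδ, c, hreg⟩ := hreg η hη
  obtain ⟨M, hM⟩ := exists_forall_ge_exists_mem_closure hl hd (half_pos hδ)
  choose! s hsm hs1 hs2 using hM
  obtain ⟨lm, hlm⟩ : ∃ lm, ∀ i, l i ≤ lm := ⟨∑ i, l i, fun i =>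
    Finset.single_le_sum (fun j _ => (hl j).le) (Finset.mem_univ i)⟩
  -- On the grid `M + j δ / 2`, finitely many semigroup elements control a window of length `lm`.
  set J := ⌈lm / (δ / 2)⌉₊
  have hev : ∀ᶠ t in F, ∀ j ∈ Finset.range (J + 1), β - η < Z (t - s (M + j * (δ / 2))) := by
    rw [Filter.eventually_all_finset]
    intro j _
    exact (tendsto_order.1 (tendsto_sub_of_mem_closure hF hp hp1 hZ hle hβ
      (hsm _ (le_add_of_nonneg_right (by positivity))))).1 _ (by linarith)
  have hwin : ∀ᶠ t in F, ∀ v ∈ Set.Icc 0 lm, β - 2 * η ≤ Z (t - (M + c) - v) := by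
    filter_upwards [hev] with t ht v hv
    set j := ⌊v / (δ / 2)⌋₊ with hj
    have hj1 : (j : ℝ) * (δ / 2) ≤ v :=
      (le_div_iff₀ (half_pos hδ)).1 (Nat.floor_le (div_nonneg hv.1 (half_pos hδ).le))
    have hj2 : v < (j + 1) * (δ / 2) :=
      (div_lt_iff₀ (half_pos hδ)).1 (Nat.lt_floor_add_one _)
    have hjJ : j ≤ J := by
      refine (Nat.floor_le_ceil _).trans (Nat.ceil_le_ceil ?_)
      gcongr
      exact hv.2
    have h1 := ht j (Finset.mem_range_succ_iff.2 hjJ)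
    have hge : M + j * (δ / 2) ≥ M := le_add_of_nonneg_right (by positivity)
    have h2 := hs1 _ hge
    have h3 := hs2 _ hge
    have h4 := hreg (t - (M + c) - v) (v + M + c - s (M + j * (δ / 2)))
      ⟨by linarith, by linarith⟩
    have h5 : t - (M + c) - v + (v + M + c - s (M + j * (δ / 2))) =
      t - s (M + j * (δ / 2)) := by ring
    rw [h5] at h4
    linarith
  have hsub : Tendsto (fun t => t - (M + c)) F atTop :=
    (tendsto_atTop_add_const_right _ (-(M + c)) tendsto_id).mono_left hF
  refine ge_of_tendsto (hA.comp hsub) ?_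
  filter_upwards [hwin] with t ht
  rw [Finset.sum_mul]
  refine Finset.sum_le_sum fun i _ => ?_
  rw [mul_assoc]
  refine mul_le_mul_of_nonneg_left ?_ (hp i).le
  have := intervalIntegral.integral_mono_on (a := t - (M + c) - l i) (b := t - (M + c))
    (by linarith [hl i]) (intervalIntegrable_const (c := β - 2 * η)) (hZint _ _)
    (fun x hx => by
      have := ht (t - (M + c) - x) ⟨by linarith [hx.2], by linarith [hx.1, hlm i]⟩
      rwa [sub_sub_cancel] at this)
  simpa only [intervalIntegral.integral_const, smul_eq_mul, sub_sub_cancel] using this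

theorem eventually_lt_of_dense [Nonempty ι]
    {p l : ι → ℝ} (hp : ∀ i, 0 < p i) (hp1 : ∑ i, p i = 1) (hl : ∀ i, 0 < l i)
    (hd : Dense (AddSubgroup.closure (Set.range l) : Set ℝ)) {Z : ℝ → ℝ} {A B : ℝ}
    (hB : ∀ t, |Z t| ≤ B)
    (hZint : ∀ a b, IntervalIntegrable Z volume a b)
    (hZ : Tendsto (fun t => Z t - ∑ i, p i * Z (t - l i)) atTop (𝓝 0))
    (hA : Tendsto (fun t => ∑ i, p i * ∫ x in (t - l i)..t, Z x) atTop (𝓝 A))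
    (hreg : ∀ η > 0, ∃ δ > 0, ∃ c, ∀ t, ∀ s ∈ Set.Icc c (c + δ), Z (t + s) ≤ Z t + η) :
    ∀ b > A / ∑ i, p i * l i, ∀ᶠ t in atTop, Z t < b := by
  have hμ : 0 < ∑ i, p i * l i :=
    Finset.sum_pos (fun i _ => mul_pos (hp i) (hl i)) Finset.univ_nonempty
  have hbdd : IsBoundedUnder (· ≤ ·) atTop Z :=
    isBoundedUnder_of ⟨B, fun t => (abs_le.1 (hB t)).2⟩
  have hcob : IsCoboundedUnder (· ≤ ·) atTop Z :=
    (isBoundedUnder_of ⟨-B, fun t => (abs_le.1 (hB t)).1⟩ :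
      IsBoundedUnder (· ≥ ·) atTop Z).isCoboundedUnder_le
  set β := limsup Z atTop
  have hle : ∀ b > β, ∀ᶠ t in atTop, Z t < b := fun b hb => eventually_lt_of_limsup_lt hb hbdd
  have hcl : MapClusterPt β atTop Z := by
    rw [mapClusterPt_iff_frequently]
    intro s hs
    obtain ⟨e, he, hes⟩ := Metric.mem_nhds_iff.1 hs
    have h1 : ∃ᶠ t in atTop, β - e < Z t := frequently_lt_of_lt_limsup hcob (by linarith)
    refine (h1.and_eventually (hle (β + e) (by linarith))).mono fun t ht => hes ?_
    rw [Metric.mem_ball, Real.dist_eq, abs_lt]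
    exact ⟨by linarith [ht.1], by linarith [ht.2]⟩
  obtain ⟨U, hU, hUZ⟩ := mapClusterPt_iff_ultrafilter.1 hcl
  have := sum_mul_le_of_tendsto hU hp hp1 hl hd hZint hZ hA hreg
    (fun η hη => (hle (β + η) (by linarith)).mono fun _ h => h.le) hUZ
  intro b hb
  refine hle b (lt_of_le_of_lt ?_ hb)
  rw [le_div_iff₀ hμ]
  linarith

/-- The renewal theorem for finitely many steps generating a dense subgroup. The total mass `A`
of the inhomogeneity enters through the conserved quantity `∑ pᵢ ∫_{t - lᵢ}^t Z`; besides
boundedness, `Z` is only required not to increase abruptly. -/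
theorem tendsto_of_dense [Nonempty ι]
    {p l : ι → ℝ} (hp : ∀ i, 0 < p i) (hp1 : ∑ i, p i = 1) (hl : ∀ i, 0 < l i)
    (hd : Dense (AddSubgroup.closure (Set.range l) : Set ℝ)) {Z : ℝ → ℝ} {A B : ℝ}
    (hB : ∀ t, |Z t| ≤ B)
    (hZint : ∀ a b, IntervalIntegrable Z volume a b)
    (hZ : Tendsto (fun t => Z t - ∑ i, p i * Z (t - l i)) atTop (𝓝 0))
    (hA : Tendsto (fun t => ∑ i, p i * ∫ x in (t - l i)..t, Z x) atTop (𝓝 A))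
    (hreg : ∀ η > 0, ∃ δ > 0, ∀ t, ∀ s ∈ Set.Icc 0 δ, Z (t + s) ≤ Z t + η) :
    Tendsto Z atTop (𝓝 (A / ∑ i, p i * l i)) := by
  rw [tendsto_order]
  refine ⟨fun b hb => ?_, eventually_lt_of_dense hp hp1 hl hd hB hZint hZ hA fun η hη => ?_⟩
  · have := eventually_lt_of_dense (Z := fun t => -Z t) (A := -A) hp hp1 hl hd
      (fun t => by simpa using hB t) (fun a b => (hZint a b).neg)
      (by simpa [sub_eq_add_neg, add_comm] using hZ.neg)
      (by simpa using hA.neg) (fun η hη => ?_) (-b) (by rw [neg_div]; linarith)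
    · filter_upwards [this] with t ht
      linarith
    · obtain ⟨δ, hδ, h⟩ := hreg η hη
      refine ⟨δ, hδ, -δ, fun t s hs => ?_⟩
      have := h (t + s) (-s) ⟨by linarith [hs.2], by linarith [hs.1]⟩
      rw [add_neg_cancel_right] at this
      linarith
  · obtain ⟨δ, hδ, h⟩ := hreg η hη
    exact ⟨δ, hδ, 0, fun t s hs => h t s (by simpa using hs)⟩

end Dense

/-! ### Averages and lattice sums -/

section Lattice

variable {ι : Type*} [Fintype ι]

/-- Continuous Cesàro means preserve limits. -/
theorem tendsto_integral_div_of_tendsto {f : ℝ → ℝ} {A : ℝ}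
    (hf : ∀ a b, IntervalIntegrable f volume a b) (hA : Tendsto f atTop (𝓝 A)) :
    Tendsto (fun x => (∫ t in (0 : ℝ)..x, f t) / x) atTop (𝓝 A) := by
  rw [Metric.tendsto_atTop]
  intro e he
  obtain ⟨T, hT⟩ := Metric.tendsto_atTop.1 hA (e / 2) (half_pos he)
  set K := |∫ t in (0 : ℝ)..T, (f t - A)| with hK
  refine ⟨max 1 (max T (2 * (K + e / 2 * |T|) / e + 1)), fun x hx => ?_⟩
  have hx1 : 1 ≤ x := (le_max_left _ _).trans hx
  have hxT : T ≤ x := (le_max_left _ _).trans ((le_max_right _ _).trans hx)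
  have hxK : 2 * (K + e / 2 * |T|) / e + 1 ≤ x :=
    (le_max_right _ _).trans ((le_max_right _ _).trans hx)
  have hx0 : 0 < x := by linarith
  have hfA : ∀ a b, IntervalIntegrable (fun t => f t - A) volume a b := fun a b =>
    (hf a b).sub intervalIntegrable_const
  have h1 : (∫ t in (0 : ℝ)..x, f t) / x - A = (∫ t in (0 : ℝ)..x, (f t - A)) / x := by
    rw [intervalIntegral.integral_sub (hf _ _) intervalIntegrable_const]
    simp
    field_simp
  have h2 : |∫ t in T..x, (f t - A)| ≤ e / 2 * |x - T| := by
    rw [← Real.norm_eq_abs]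
    refine intervalIntegral.norm_integral_le_of_norm_le_const (fun t ht => ?_)
    rw [Set.uIoc_of_le hxT] at ht
    exact (hT t ht.1.le).le
  have h3 : |x - T| ≤ x + |T| := by
    have := abs_sub x T
    rwa [abs_of_pos hx0] at this
  rw [Real.dist_eq, h1, abs_div, abs_of_pos hx0, div_lt_iff₀ hx0,
    ← intervalIntegral.integral_add_adjacent_intervals (hfA 0 T) (hfA T x)]
  have h4 := abs_add_le (∫ t in (0 : ℝ)..T, (f t - A)) (∫ t in T..x, (f t - A))
  have h5 : 2 * (K + e / 2 * |T|) < e * x := by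
    have : 2 * (K + e / 2 * |T|) / e < x := by linarith
    rw [div_lt_iff₀ he] at this
    linarith
  nlinarith

/-- Averages of a bounded function with asymptotically constant `∑ pᵢ ∫_{t - lᵢ}^t Z` converge,
whatever the arithmetic nature of the steps `lᵢ`. -/
theorem tendsto_average [Nonempty ι]
    {p l : ι → ℝ} (hp : ∀ i, 0 < p i) (hl : ∀ i, 0 < l i) {Z : ℝ → ℝ} {A B : ℝ}
    (hB : ∀ t, |Z t| ≤ B)
    (hZint : ∀ a b, IntervalIntegrable Z volume a b)
    (hA : Tendsto (fun t => ∑ i, p i * ∫ x in (t - l i)..t, Z x) atTop (𝓝 A)) :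
    Tendsto (fun x => (∫ t in (0 : ℝ)..x, Z t) / x) atTop (𝓝 (A / ∑ i, p i * l i)) := by
  have hμ : 0 < ∑ i, p i * l i :=
    Finset.sum_pos (fun i _ => mul_pos (hp i) (hl i)) Finset.univ_nonempty
  set I : ℝ → ℝ := fun x => ∫ t in (0 : ℝ)..x, Z t with hI
  have hIc : Continuous I := intervalIntegral.continuous_primitive hZint 0
  have hsub : ∀ a b, (∫ t in a..b, Z t) = I b - I a := fun a b =>
    (intervalIntegral.integral_interval_sub_left (hZint _ _) (hZint _ _)).symm
  have hIlip : ∀ a b, |I b - I a| ≤ B * |b - a| := fun a b => by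
    rw [← hsub, ← Real.norm_eq_abs]
    exact intervalIntegral.norm_integral_le_of_norm_le_const fun t _ => hB t
  simp only [hsub] at hA
  have hmean := tendsto_integral_div_of_tendsto
    (fun a b => Continuous.intervalIntegrable (by fun_prop) a b) hA
  -- `∫₀ˣ (I t - I (t - c)) dt` is a difference of integrals of `I` over intervals of length `c`.
  have hone : ∀ c > 0, ∃ K, ∀ x, |(∫ t in (0 : ℝ)..x, (I t - I (t - c))) - c * I x| ≤ K := by
    intro c hc
    refine ⟨B * c * c + |∫ t in (-c)..0, I t|, fun x => ?_⟩
    have hii : ∀ a b, IntervalIntegrable I volume a b := fun a b => hIc.intervalIntegrable a b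
    have h1 : (∫ t in (0 : ℝ)..x, (I t - I (t - c))) =
        (∫ t in (x - c)..x, I t) - ∫ t in (-c)..0, I t := by
      rw [intervalIntegral.integral_sub (hii _ _)
        (Continuous.intervalIntegrable (by fun_prop) _ _),
        intervalIntegral.integral_comp_sub_right (fun t => I t) c, zero_sub,
        ← intervalIntegral.integral_add_adjacent_intervals (hii (-c) 0) (hii 0 (x - c)),
        ← intervalIntegral.integral_add_adjacent_intervals (hii 0 (x - c)) (hii (x - c) x)]
      ring
    have h2 : (∫ t in (x - c)..x, I t) - c * I x = ∫ t in (x - c)..x, (I t - I x) := by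
      rw [intervalIntegral.integral_sub (hii _ _) intervalIntegrable_const]
      simp
    have h3 : |∫ t in (x - c)..x, (I t - I x)| ≤ B * c * |x - (x - c)| := by
      rw [← Real.norm_eq_abs]
      refine intervalIntegral.norm_integral_le_of_norm_le_const fun t ht => ?_
      rw [Set.uIoc_of_le (by linarith)] at ht
      refine (hIlip x t).trans ?_
      have hB0 : 0 ≤ B := (abs_nonneg _).trans (hB 0)
      gcongr
      rw [abs_le]
      exact ⟨by linarith [ht.1], by linarith [ht.2]⟩
    rw [sub_sub_cancel, abs_of_pos hc] at h3
    rw [h1, sub_right_comm, h2]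
    exact (abs_sub _ _).trans (by gcongr)
  choose K hK using fun i => hone (l i) (hl i)
  have hdiff : Tendsto (fun x => ((∫ t in (0 : ℝ)..x, ∑ i, p i * (I t - I (t - l i))) -
      (∑ i, p i * l i) * I x) / x) atTop (𝓝 0) := by
    refine squeeze_zero_norm' (a := fun x => (∑ i, p i * K i) / x) ?_
      (tendsto_const_nhds.div_atTop tendsto_id)
    filter_upwards [eventually_gt_atTop 0] with x hx
    rw [norm_div, Real.norm_eq_abs, Real.norm_eq_abs, abs_of_pos hx]
    gcongr
    rw [intervalIntegral.integral_finsetSum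
      (fun i _ => Continuous.intervalIntegrable (by fun_prop) _ _), Finset.sum_mul,
      ← Finset.sum_sub_distrib]
    refine (Finset.abs_sum_le_sum_abs _ _).trans (Finset.sum_le_sum fun i _ => ?_)
    rw [intervalIntegral.integral_const_mul, mul_assoc, ← mul_sub, abs_mul, abs_of_pos (hp i)]
    exact mul_le_mul_of_nonneg_left (hK i x) (hp i).le
  have := (hmean.sub hdiff).div_const (∑ i, p i * l i)
  rw [sub_zero] at this
  refine this.congr fun x => ?_
  rw [← sub_div, sub_sub_cancel]
  field_simp
  rfl

/-- If all steps are multiples of `h` and `Z` converges, then the sums of the inhomogeneity along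
the cosets of `ℕ h` are given by the limit and the values of `Z` before the starting point. -/
theorem tendsto_sum_of_lattice {p : ι → ℝ} {m : ι → ℕ} {h c : ℝ} (hh : 0 < h) {Z : ℝ → ℝ}
    (hZ : Tendsto Z atTop (𝓝 c)) (t : ℝ) :
    Tendsto (fun J : ℕ => ∑ j ∈ Finset.range J,
        ∑ i, p i * (Z (t + j * h) - Z (t + j * h - m i * h))) atTop
      (𝓝 (∑ i, p i * (m i * c) -
        ∑ i, p i * ∑ k ∈ Finset.range (m i), Z (t - (k + 1) * h))) := by
  set E : ℕ → ℝ := fun J => ∑ i, p i * ∑ k ∈ Finset.range (m i), Z (t + J * h - (k + 1) * h)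
    with hE
  have hstep : ∀ J : ℕ, ∑ i, p i * (Z (t + J * h) - Z (t + J * h - m i * h)) = E (J + 1) - E J := by
    intro J
    rw [hE, ← Finset.sum_sub_distrib]
    refine Finset.sum_congr rfl fun i _ => ?_
    rw [← mul_sub, ← Finset.sum_sub_distrib]
    have := Finset.sum_range_sub' (fun k : ℕ => Z (t + J * h - k * h)) (m i)
    rw [Nat.cast_zero, zero_mul, sub_zero] at this
    rw [← this]
    congr 1
    refine Finset.sum_congr rfl fun k _ => ?_
    congr 2
    · push_cast; ring
    · push_cast; ring
  have hlim : Tendsto E atTop (𝓝 (∑ i, p i * (m i * c))) := by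
    refine tendsto_finsetSum _ fun i _ => Tendsto.const_mul _ ?_
    have : (m i : ℝ) * c = ∑ k ∈ Finset.range (m i), c := by simp
    rw [this]
    refine tendsto_finsetSum _ fun k _ => hZ.comp ?_
    have h1 : Tendsto (fun J : ℕ => (J : ℝ) * h) atTop atTop :=
      tendsto_natCast_atTop_atTop.atTop_mul_const hh
    refine (tendsto_atTop_add_const_right _ (t - (k + 1) * h) h1).congr fun J => ?_
    ring
  have h0 : ∑ i, p i * ∑ k ∈ Finset.range (m i), Z (t - (k + 1) * h) = E 0 := by
    simp [hE]
  rw [h0]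
  refine (hlim.sub_const (E 0)).congr fun J => ?_
  rw [Finset.sum_congr rfl fun j _ => hstep j, Finset.sum_range_sub]

end Lattice

/-! ### Renewal equations with exponential sources -/

section Exp

/-- The exponential function with rate `a > 0` is not a combination of decaying exponentials and
a constant, even on a short interval. -/
theorem false_of_sum_exp_eq_const {κ θ : ℕ → ℝ} {d : ℕ} {a C L τ h : ℝ}
    (hθ : ∀ k < d, 0 < θ k) (ha : 0 < a) (hL : 0 < L) (hh : 0 < h)
    (heq : ∀ t ∈ Set.Ioo τ (τ + h),
      ∑ k ∈ Finset.range d, κ k * Real.exp (-θ k * t) + L * Real.exp (a * t) = C) : False := by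
  have hf : AnalyticOnNhd ℝ (fun t : ℝ =>
      ∑ k ∈ Finset.range d, κ k * Real.exp (-θ k * t) + L * Real.exp (a * t)) Set.univ := by
    intro t _
    fun_prop
  have hev : (fun t : ℝ => ∑ k ∈ Finset.range d, κ k * Real.exp (-θ k * t) +
      L * Real.exp (a * t)) =ᶠ[𝓝 (τ + h / 2)] fun _ => C := by
    filter_upwards [Ioo_mem_nhds (show τ < τ + h / 2 by linarith)
      (show τ + h / 2 < τ + h by linarith)] with t ht using heq t ht
  have hall := hf.eq_of_eventuallyEq analyticOnNhd_const hev
  have h1 : Tendsto (fun t : ℝ => ∑ k ∈ Finset.range d, κ k * Real.exp (-θ k * t)) atTop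
      (𝓝 (∑ k ∈ Finset.range d, κ k * 0)) := by
    refine tendsto_finsetSum _ fun k hk => Tendsto.const_mul _ ?_
    exact Real.tendsto_exp_atBot.comp
      (tendsto_id.const_mul_atTop_of_neg (neg_neg_of_pos (hθ k (Finset.mem_range.1 hk))))
  have h2 : Tendsto (fun t : ℝ => L * Real.exp (a * t)) atTop atTop :=
    (Real.tendsto_exp_atTop.comp (tendsto_id.const_mul_atTop ha)).const_mul_atTop hL
  have h3 := h1.add_atTop h2
  rw [hall] at h3
  exact not_tendsto_const_atTop _ _ h3

/-- The total mass of the inhomogeneity which is `lam e ^ (a t)` up to time `τ` and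
`∑ κₖ e ^ (-θₖ t)` afterwards. -/
noncomputable def sourceMass (d : ℕ) (κ θ : ℕ → ℝ) (a lam τ : ℝ) : ℝ :=
  lam * Real.exp (a * τ) / a + ∑ k ∈ Finset.range d, κ k * Real.exp (-θ k * τ) / θ k

theorem integral_exp_mul_of_ne_zero {c : ℝ} (hc : c ≠ 0) (x y : ℝ) :
    ∫ t in x..y, Real.exp (c * t) = (Real.exp (c * y) - Real.exp (c * x)) / c := by
  rw [intervalIntegral.integral_comp_mul_left (fun t => Real.exp t) hc, integral_exp,
    smul_eq_mul, inv_mul_eq_div]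

/-- A function solving the renewal equation with steps `l i` and weights `p i`, which is the
exponential `Λ e ^ (a t)` up to time `τ`, while the inhomogeneity from time `τ` on is
nonnegative and a combination `∑ κₖ e ^ (-θₖ t)` of decaying exponentials. The bound `growth` is the
only regularity required. -/
structure IsExpSolution {ι : Type*} [Fintype ι] (p l : ι → ℝ) (Z : ℝ → ℝ) (d : ℕ)
    (κ θ : ℕ → ℝ) (a Λ τ : ℝ) : Prop where
  weight_pos : ∀ i, 0 < p i
  weight_sum : ∑ i, p i = 1
  step_pos : ∀ i, 0 < l i
  decay : ∀ k < d, 0 < θ k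
  rate_pos : 0 < a
  mass_pos : 0 < Λ
  nonneg : ∀ t, 0 ≤ Z t
  growth : ∀ t, ∀ s ≥ 0, Z (t + s) ≤ Real.exp (a * s) * Z t
  intervalIntegrable : ∀ x y, IntervalIntegrable Z volume x y
  eq_exp : ∀ t ≤ τ, Z t = Λ * Real.exp (a * t)
  renewal : ∀ t ≥ τ, Z t - ∑ i, p i * Z (t - l i) =
    ∑ k ∈ Finset.range d, κ k * Real.exp (-θ k * t)
  source_nonneg : ∀ t ≥ τ, 0 ≤ ∑ k ∈ Finset.range d, κ k * Real.exp (-θ k * t)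

namespace IsExpSolution

variable {ι : Type*} [Fintype ι] {p l : ι → ℝ} {Z : ℝ → ℝ} {d : ℕ} {κ θ : ℕ → ℝ} {a Λ τ : ℝ}

theorem index_nonempty (H : IsExpSolution p l Z d κ θ a Λ τ) : Nonempty ι := by
  by_contra h
  rw [not_nonempty_iff] at h
  simpa using H.weight_sum

/-- The weighted sum of the integrals of `Z` over one step is the mass of the inhomogeneity up to
time `t`. Up to time `τ`, where `Z` is exponential, the inhomogeneity has the amplitude
`Λ (1 - ∑ pᵢ e ^ (-a lᵢ))`. -/
theorem conserved_eq (H : IsExpSolution p l Z d κ θ a Λ τ) {t : ℝ} (ht : τ ≤ t) :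
    ∑ i, p i * ∫ x in (t - l i)..t, Z x =
      sourceMass d κ θ a (Λ * (1 - ∑ i, p i * Real.exp (-a * l i))) τ -
        ∑ k ∈ Finset.range d, κ k * Real.exp (-θ k * t) / θ k := by
  have hii := H.intervalIntegrable
  have ha := H.rate_pos
  have hτ : ∀ i, ∫ x in (τ - l i)..τ, Z x =
      Λ * Real.exp (a * τ) / a * (1 - Real.exp (-a * l i)) := fun i => by
    have : ∫ x in (τ - l i)..τ, Z x = ∫ x in (τ - l i)..τ, Λ * Real.exp (a * x) := by
      refine intervalIntegral.integral_congr fun x hx => H.eq_exp x ?_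
      rw [Set.uIcc_of_le (by linarith [H.step_pos i])] at hx
      exact hx.2
    rw [this, intervalIntegral.integral_const_mul, integral_exp_mul_of_ne_zero ha.ne',
      show a * (τ - l i) = a * τ + -a * l i by ring, Real.exp_add]
    ring
  have hdiff : ∀ i, ∫ x in (t - l i)..t, Z x =
      (∫ x in (τ - l i)..τ, Z x) + ((∫ x in τ..t, Z x) - ∫ x in τ..t, Z (x - l i)) := fun i => by
    rw [intervalIntegral.integral_comp_sub_right Z (l i)]
    have h1 := intervalIntegral.integral_add_adjacent_intervals (hii (τ - l i) τ) (hii τ t)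
    have h2 := intervalIntegral.integral_add_adjacent_intervals (hii (τ - l i) (t - l i))
      (hii (t - l i) t)
    linarith
  have hcomp : ∀ i, IntervalIntegrable (fun x => Z (x - l i)) volume τ t := fun i => by
    simpa using (hii (τ - l i) (t - l i)).comp_sub_right (l i)
  have hsrc : ∑ i, p i * ((∫ x in τ..t, Z x) - ∫ x in τ..t, Z (x - l i)) =
      ∫ x in τ..t, ∑ k ∈ Finset.range d, κ k * Real.exp (-θ k * x) := by
    calc _ = ∫ x in τ..t, (Z x - ∑ i, p i * Z (x - l i)) := by
          rw [intervalIntegral.integral_sub (hii _ _)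
            (by
              have := IntervalIntegrable.sum Finset.univ
                fun i _ => (hcomp i).const_mul (p i)
              rwa [Finset.sum_fn] at this),
            intervalIntegral.integral_finsetSum (fun i _ => (hcomp i).const_mul _)]
          simp only [mul_sub, Finset.sum_sub_distrib, intervalIntegral.integral_const_mul]
          rw [← Finset.sum_mul, H.weight_sum, one_mul]
      _ = _ := by
          refine intervalIntegral.integral_congr fun x hx => H.renewal x ?_
          rw [Set.uIcc_of_le ht] at hx
          exact hx.1
  have hint : ∫ x in τ..t, ∑ k ∈ Finset.range d, κ k * Real.exp (-θ k * x) =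
      ∑ k ∈ Finset.range d, κ k * Real.exp (-θ k * τ) / θ k -
        ∑ k ∈ Finset.range d, κ k * Real.exp (-θ k * t) / θ k := by
    rw [intervalIntegral.integral_finsetSum
      (fun k _ => Continuous.intervalIntegrable (by fun_prop) _ _), ← Finset.sum_sub_distrib]
    refine Finset.sum_congr rfl fun k hk => ?_
    have := H.decay k (Finset.mem_range.1 hk)
    rw [intervalIntegral.integral_const_mul, integral_exp_mul_of_ne_zero (by linarith)]
    field_simp
    ring
  have hmass : ∑ i, p i * ∫ x in (τ - l i)..τ, Z x =
      Λ * (1 - ∑ i, p i * Real.exp (-a * l i)) * Real.exp (a * τ) / a := by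
    have h1 : (1 : ℝ) - ∑ i, p i * Real.exp (-a * l i) =
        ∑ i, p i * (1 - Real.exp (-a * l i)) := by
      simp only [mul_sub, Finset.sum_sub_distrib, mul_one, H.weight_sum]
    rw [h1, Finset.mul_sum, Finset.sum_mul, Finset.sum_div]
    refine Finset.sum_congr rfl fun i _ => ?_
    rw [hτ]
    ring
  calc _ = ∑ i, p i * (∫ x in (τ - l i)..τ, Z x) +
        ∑ i, p i * ((∫ x in τ..t, Z x) - ∫ x in τ..t, Z (x - l i)) := by
        rw [← Finset.sum_add_distrib]
        exact Finset.sum_congr rfl fun i _ => by rw [hdiff]; ring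
    _ = _ := by
        rw [hmass, hsrc, hint, sourceMass]
        ring

theorem tendsto_exp_sum (H : IsExpSolution p l Z d κ θ a Λ τ) (κ' : ℕ → ℝ) :
    Tendsto (fun t : ℝ => ∑ k ∈ Finset.range d, κ' k * Real.exp (-θ k * t)) atTop (𝓝 0) := by
  have : (0 : ℝ) = ∑ k ∈ Finset.range d, κ' k * 0 := by simp
  rw [this]
  refine tendsto_finsetSum _ fun k hk => Tendsto.const_mul _ ?_
  exact Real.tendsto_exp_atBot.comp
    (tendsto_id.const_mul_atTop_of_neg (neg_neg_of_pos (H.decay k (Finset.mem_range.1 hk))))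

theorem tendsto_conserved (H : IsExpSolution p l Z d κ θ a Λ τ) :
    Tendsto (fun t => ∑ i, p i * ∫ x in (t - l i)..t, Z x) atTop
      (𝓝 (sourceMass d κ θ a (Λ * (1 - ∑ i, p i * Real.exp (-a * l i))) τ)) := by
  have h := (H.tendsto_exp_sum fun k => κ k / θ k).const_sub
    (sourceMass d κ θ a (Λ * (1 - ∑ i, p i * Real.exp (-a * l i))) τ)
  rw [sub_zero] at h
  refine h.congr' ?_
  filter_upwards [eventually_ge_atTop τ] with t ht
  rw [H.conserved_eq ht]
  congr 1
  exact Finset.sum_congr rfl fun k _ => by ring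

theorem tendsto_source (H : IsExpSolution p l Z d κ θ a Λ τ) :
    Tendsto (fun t => Z t - ∑ i, p i * Z (t - l i)) atTop (𝓝 0) := by
  refine (H.tendsto_exp_sum κ).congr' ?_
  filter_upwards [eventually_ge_atTop τ] with t ht
  exact (H.renewal t ht).symm

/-- The mass of the inhomogeneity after time `x` decreases in `x`. -/
theorem sum_exp_div_anti (H : IsExpSolution p l Z d κ θ a Λ τ) {x y : ℝ} (hx : τ ≤ x)
    (hxy : x ≤ y) :
    ∑ k ∈ Finset.range d, κ k * Real.exp (-θ k * y) / θ k ≤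
      ∑ k ∈ Finset.range d, κ k * Real.exp (-θ k * x) / θ k := by
  have h : 0 ≤ ∫ t in x..y, ∑ k ∈ Finset.range d, κ k * Real.exp (-θ k * t) :=
    intervalIntegral.integral_nonneg hxy fun t ht => H.source_nonneg t (hx.trans ht.1)
  rw [intervalIntegral.integral_finsetSum
    (fun k _ => Continuous.intervalIntegrable (by fun_prop) _ _)] at h
  rw [← sub_nonneg, ← Finset.sum_sub_distrib]
  refine h.trans_eq (Finset.sum_congr rfl fun k hk => ?_)
  have := H.decay k (Finset.mem_range.1 hk)
  rw [intervalIntegral.integral_const_mul, integral_exp_mul_of_ne_zero (by linarith)]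
  field_simp
  ring

theorem one_sub_sum_pos (H : IsExpSolution p l Z d κ θ a Λ τ) :
    0 < 1 - ∑ i, p i * Real.exp (-a * l i) := by
  have := H.index_nonempty
  rw [sub_pos, ← H.weight_sum]
  refine Finset.sum_lt_sum_of_nonempty Finset.univ_nonempty fun i _ => ?_
  have h1 : Real.exp (-a * l i) < 1 := by
    rw [Real.exp_lt_one_iff]
    nlinarith [H.rate_pos, H.step_pos i, mul_pos H.rate_pos (H.step_pos i)]
  nlinarith [H.weight_pos i]

theorem sourceMass_pos (H : IsExpSolution p l Z d κ θ a Λ τ) :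
    0 < sourceMass d κ θ a (Λ * (1 - ∑ i, p i * Real.exp (-a * l i))) τ := by
  have h1 : 0 ≤ ∑ k ∈ Finset.range d, κ k * Real.exp (-θ k * τ) / θ k := by
    have h := H.tendsto_exp_sum fun k => κ k / θ k
    refine le_of_tendsto h ?_
    filter_upwards [eventually_ge_atTop τ] with t ht
    refine le_trans (le_of_eq ?_) (H.sum_exp_div_anti le_rfl ht)
    exact Finset.sum_congr rfl fun k _ => by ring
  have h2 := H.one_sub_sum_pos
  have h3 := H.mass_pos
  have h4 := H.rate_pos
  unfold sourceMass
  positivity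

/-- `Z` is bounded: the conserved quantity controls the integral of `Z` over an interval of fixed
length, and `growth` turns this into a pointwise bound. -/
theorem exists_bound (H : IsExpSolution p l Z d κ θ a Λ τ) : ∃ B, ∀ t, |Z t| ≤ B := by
  obtain ⟨i⟩ := H.index_nonempty
  have ha := H.rate_pos
  have hpi := H.weight_pos i
  have hli := H.step_pos i
  set A := sourceMass d κ θ a (Λ * (1 - ∑ i, p i * Real.exp (-a * l i))) τ
  have hcons : ∀ t ≥ τ, ∑ i, p i * ∫ x in (t - l i)..t, Z x ≤ A := fun t ht => by
    refine ge_of_tendsto H.tendsto_conserved ?_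
    filter_upwards [eventually_ge_atTop t] with s hs
    rw [H.conserved_eq ht, H.conserved_eq (ht.trans hs)]
    exact sub_le_sub_left (H.sum_exp_div_anti ht hs) _
  refine ⟨max (Λ * Real.exp (a * τ)) (A * Real.exp (a * l i) / (p i * l i)), fun t => ?_⟩
  rw [abs_of_nonneg (H.nonneg t)]
  rcases le_total t τ with ht | ht
  · refine le_max_of_le_left ?_
    rw [H.eq_exp t ht]
    have := H.mass_pos
    gcongr
  · refine le_max_of_le_right ?_
    have h1 : p i * ∫ x in (t - l i)..t, Z x ≤ A := by
      refine le_trans ?_ (hcons t ht)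
      exact Finset.single_le_sum (f := fun i => p i * ∫ x in (t - l i)..t, Z x)
        (fun j _ => mul_nonneg (H.weight_pos j).le (intervalIntegral.integral_nonneg
          (by linarith [H.step_pos j]) fun x _ => H.nonneg x)) (Finset.mem_univ i)
    have h2 : l i * (Real.exp (-(a * l i)) * Z t) ≤ ∫ x in (t - l i)..t, Z x := by
      have := intervalIntegral.integral_mono_on (a := t - l i) (b := t) (by linarith)
        (intervalIntegrable_const (c := Real.exp (-(a * l i)) * Z t))
        (H.intervalIntegrable _ _) (fun x hx => by
          have h3 := H.growth x (t - x) (by linarith [hx.2])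
          rw [add_sub_cancel] at h3
          have h4 : Real.exp (a * (t - x)) ≤ Real.exp (a * l i) := by
            gcongr
            linarith [hx.1]
          have h5 : Z t ≤ Real.exp (a * l i) * Z x :=
            h3.trans (mul_le_mul_of_nonneg_right h4 (H.nonneg x))
          rw [Real.exp_neg, inv_mul_le_iff₀ (Real.exp_pos _)]
          exact h5)
      simpa only [intervalIntegral.integral_const, smul_eq_mul, sub_sub_cancel] using this
    rw [le_div_iff₀ (by positivity)]
    rw [Real.exp_neg] at h2
    have h6 := (mul_le_mul_of_nonneg_left h2 hpi.le).trans h1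
    have := Real.exp_pos (a * l i)
    field_simp at h6
    rw [mul_comm (l i) a] at h6
    linarith

theorem tendsto_average (H : IsExpSolution p l Z d κ θ a Λ τ) :
    Tendsto (fun x => (∫ t in (0 : ℝ)..x, Z t) / x) atTop
      (𝓝 (sourceMass d κ θ a (Λ * (1 - ∑ i, p i * Real.exp (-a * l i))) τ /
        ∑ i, p i * l i)) := by
  have := H.index_nonempty
  obtain ⟨B, hB⟩ := H.exists_bound
  exact Renewal.tendsto_average H.weight_pos H.step_pos hB H.intervalIntegrable
    H.tendsto_conserved

theorem tendsto_of_dense (H : IsExpSolution p l Z d κ θ a Λ τ)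
    (hd : Dense (AddSubgroup.closure (Set.range l) : Set ℝ)) :
    Tendsto Z atTop
      (𝓝 (sourceMass d κ θ a (Λ * (1 - ∑ i, p i * Real.exp (-a * l i))) τ /
        ∑ i, p i * l i)) := by
  have := H.index_nonempty
  obtain ⟨B, hB⟩ := H.exists_bound
  refine Renewal.tendsto_of_dense H.weight_pos H.weight_sum H.step_pos hd hB
    H.intervalIntegrable H.tendsto_source H.tendsto_conserved fun η hη => ?_
  have hB0 : 0 ≤ B := (abs_nonneg _).trans (hB 0)
  have hc : Tendsto (fun s => (Real.exp (a * s) - 1) * B) (𝓝 0) (𝓝 0) := by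
    have : Continuous fun s => (Real.exp (a * s) - 1) * B := by fun_prop
    simpa using this.tendsto 0
  obtain ⟨δ, hδ, h⟩ := Metric.eventually_nhds_iff.1 ((tendsto_order.1 hc).2 η hη)
  refine ⟨δ / 2, half_pos hδ, fun t s hs => ?_⟩
  have h1 := h (y := s) (by
    rw [Real.dist_eq, sub_zero, abs_of_nonneg hs.1]
    linarith [hs.2])
  have h2 := H.growth t s hs.1
  have h3 : 1 ≤ Real.exp (a * s) := Real.one_le_exp (mul_nonneg H.rate_pos.le hs.1)
  have h4 := (abs_le.1 (hB t)).2
  nlinarith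

/-- If all steps are multiples of one number, `Z` does not converge: otherwise the sums of the
inhomogeneity over the cosets of the lattice would be constant, but over a short interval they
are a combination of one growing and several decaying exponentials. -/
theorem not_tendsto_of_lattice (H : IsExpSolution p l Z d κ θ a Λ τ) {h : ℝ} (hh : 0 < h)
    {m : ι → ℕ} (hm : ∀ i, l i = m i * h) (c : ℝ) : ¬ Tendsto Z atTop (𝓝 c) := by
  intro hZ
  have hm0 : ∀ i, 0 < m i := fun i => by
    have := H.step_pos i
    rw [hm] at this
    exact Nat.pos_of_ne_zero fun h0 => by simp [h0] at this
  have := H.index_nonempty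
  refine false_of_sum_exp_eq_const (κ := fun k => κ k / (1 - Real.exp (-θ k * h))) (θ := θ)
    (d := d) (a := a) (L := ∑ i, p i * ∑ k ∈ Finset.range (m i),
      Λ * Real.exp (-(a * ((k + 1) * h))))
    (τ := τ) (C := ∑ i, p i * (m i * c)) H.decay H.rate_pos ?_ hh fun t ht => ?_
  · refine Finset.sum_pos (fun i _ => mul_pos (H.weight_pos i) (Finset.sum_pos (fun k _ =>
      mul_pos H.mass_pos (Real.exp_pos _)) ?_)) Finset.univ_nonempty
    simpa using (hm0 i).ne'
  · have h1 := tendsto_sum_of_lattice (p := p) (m := m) hh hZ t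
    have h2 : Tendsto (fun J : ℕ => ∑ j ∈ Finset.range J,
        ∑ i, p i * (Z (t + j * h) - Z (t + j * h - m i * h))) atTop
        (𝓝 (∑ k ∈ Finset.range d, κ k / (1 - Real.exp (-θ k * h)) * Real.exp (-θ k * t))) := by
      have h3 : ∀ j : ℕ, ∑ i, p i * (Z (t + j * h) - Z (t + j * h - m i * h)) =
          ∑ k ∈ Finset.range d, κ k * Real.exp (-θ k * t) * Real.exp (-θ k * h) ^ j := by
        intro j
        have h4 := H.renewal (t + j * h) (by
          have : 0 ≤ (j : ℝ) * h := by positivity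
          linarith [ht.1])
        simp only [mul_sub, Finset.sum_sub_distrib, ← Finset.sum_mul, H.weight_sum, one_mul,
          ← hm]
        rw [h4]
        refine Finset.sum_congr rfl fun k _ => ?_
        rw [← Real.exp_nat_mul, mul_assoc, ← Real.exp_add]
        ring_nf
      simp only [h3]
      refine HasSum.tendsto_sum_nat (hasSum_sum fun k hk => ?_)
      have h5 : Real.exp (-θ k * h) < 1 := by
        rw [Real.exp_lt_one_iff]
        nlinarith [mul_pos (H.decay k (Finset.mem_range.1 hk)) hh]
      have h6 := (hasSum_geometric_of_lt_one (Real.exp_pos _).le h5).mul_left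
        (κ k * Real.exp (-θ k * t))
      rw [div_mul_eq_mul_div, div_eq_mul_inv]
      exact h6
    have h7 : ∑ i, p i * ∑ k ∈ Finset.range (m i), Z (t - (k + 1) * h) =
        (∑ i, p i * ∑ k ∈ Finset.range (m i), Λ * Real.exp (-(a * ((k + 1) * h)))) *
          Real.exp (a * t) := by
      rw [Finset.sum_mul]
      refine Finset.sum_congr rfl fun i _ => ?_
      rw [mul_assoc, Finset.sum_mul]
      congr 1
      refine Finset.sum_congr rfl fun k _ => ?_
      rw [H.eq_exp _ (by
        have : 0 ≤ (k : ℝ) * h := by positivity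
        linarith [ht.2]), mul_assoc, ← Real.exp_add]
      ring_nf
    have h8 := tendsto_nhds_unique h1 h2
    rw [h7] at h8
    linarith

end IsExpSolution

end Exp

end Renewal

namespace SelfSimilarTiling

/-! ### Inner volumes -/

section InnerVolume

variable {d N : ℕ}

/-- A map of `ℝᵈ` scaling all distances by `ρ > 0` is a linear isometry followed by a homothety
and a translation. -/
theorem exists_eq_smul_add {f : EuclideanSpace ℝ (Fin d) → EuclideanSpace ℝ (Fin d)} {ρ : ℝ}
    (hρ : 0 < ρ) (hf : ∀ x y, dist (f x) (f y) = ρ * dist x y) :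
    ∃ (L : EuclideanSpace ℝ (Fin d) ≃ₗᵢ[ℝ] EuclideanSpace ℝ (Fin d))
      (c : EuclideanSpace ℝ (Fin d)), ∀ x, f x = ρ • L x + c := by
  have hI : Isometry fun x => ρ⁻¹ • f x := by
    refine Isometry.of_dist_eq fun x y => ?_
    rw [dist_smul₀, hf, Real.norm_eq_abs, abs_of_pos (inv_pos.2 hρ)]
    field_simp
  set J := hI.affineIsometryOfStrictConvexSpace
  refine ⟨J.linearIsometry.toLinearIsometryEquiv rfl, f 0, fun x => ?_⟩
  have h1 := J.map_vadd 0 x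
  have h2 : ∀ x, J x = ρ⁻¹ • f x := fun x => rfl
  simp only [vadd_eq_add, add_zero, h2] at h1
  rw [LinearIsometry.coe_toLinearIsometryEquiv, ← smul_inv_smul₀ hρ.ne' (f x), h1, smul_add,
    smul_inv_smul₀ hρ.ne']

open scoped Pointwise in
/-- Scaling law of the inner volume under similarities. -/
theorem innerVolume_image {f : EuclideanSpace ℝ (Fin d) → EuclideanSpace ℝ (Fin d)} {ρ : ℝ}
    (hρ : 0 < ρ) (hf : ∀ x y, dist (f x) (f y) = ρ * dist x y)
    (A : Set (EuclideanSpace ℝ (Fin d))) (ε : ℝ) :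
    innerVolume (f '' A) ε = ENNReal.ofReal (ρ ^ d) * innerVolume A (ε / ρ) := by
  obtain ⟨L, c, hL⟩ := exists_eq_smul_add hρ hf
  obtain rfl : f = fun x => ρ • L x + c := funext hL
  have himg : ∀ B : Set (EuclideanSpace ℝ (Fin d)), (fun x => ρ • L x + c) '' B =
      (fun x => x + c) '' (ρ • (L '' B)) := fun B => by
    rw [← Set.image_smul, Set.image_image, Set.image_image]
  have hvol : ∀ B : Set (EuclideanSpace ℝ (Fin d)), volume ((fun x => ρ • L x + c) '' B) =
      ENNReal.ofReal (ρ ^ d) * volume B := fun B => by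
    rw [himg, Set.image_add_right, measure_preimage_add_right, Measure.addHaar_smul,
      finrank_euclideanSpace_fin, abs_of_pos (pow_pos hρ d), L.image_eq_preimage_symm]
    congr 1
    exact L.symm.measurePreserving.measure_preimage_emb
      L.symm.toHomeomorph.measurableEmbedding B
  have hbij : Function.Bijective fun x => ρ • L x + c :=
    ((Equiv.addRight c).bijective.comp (MulAction.bijective (Units.mk0 ρ hρ.ne'))).comp L.bijective
  have hdist : ∀ (B : Set (EuclideanSpace ℝ (Fin d))) x,
      Metric.infDist (ρ • L x + c) ((fun x => ρ • L x + c) '' B) = ρ * Metric.infDist x B := by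
    intro B x
    rw [himg, Metric.infDist_image (isometry_add_right c) (x := ρ • L x), infDist_smul₀ hρ.ne',
      Metric.infDist_image L.isometry, Real.norm_eq_abs, abs_of_pos hρ]
  have hset : {x | x ∈ (fun x => ρ • L x + c) '' A ∧
      Metric.infDist x ((fun x => ρ • L x + c) '' A)ᶜ ≤ ε} =
      (fun x => ρ • L x + c) '' {x | x ∈ A ∧ Metric.infDist x Aᶜ ≤ ε / ρ} := by
    rw [← Set.image_compl_eq hbij]
    ext y
    constructor
    · rintro ⟨⟨x, hx, rfl⟩, hy⟩
      rw [hdist] at hy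
      exact ⟨x, ⟨hx, (le_div_iff₀' hρ).2 hy⟩, rfl⟩
    · rintro ⟨x, ⟨hx, hy⟩, rfl⟩
      refine ⟨⟨x, hx, rfl⟩, ?_⟩
      rw [hdist]
      exact (le_div_iff₀' hρ).1 hy
  rw [innerVolume, hset, hvol, innerVolume]

theorem isOpen_image {f : EuclideanSpace ℝ (Fin d) → EuclideanSpace ℝ (Fin d)} {ρ : ℝ}
    (hρ : 0 < ρ) (hf : ∀ x y, dist (f x) (f y) = ρ * dist x y)
    {A : Set (EuclideanSpace ℝ (Fin d))} (hA : IsOpen A) : IsOpen (f '' A) := by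
  obtain ⟨L, c, hL⟩ := exists_eq_smul_add hρ hf
  have : f = (Homeomorph.addRight c) ∘ (Homeomorph.smulOfNeZero ρ hρ.ne') ∘ L := funext hL
  rw [this]
  exact ((Homeomorph.addRight c).isOpenMap.comp
    ((Homeomorph.smulOfNeZero ρ hρ.ne').isOpenMap.comp L.toHomeomorph.isOpenMap)) A hA

/-- A point of one of several disjoint open sets is as far from the complement of that set as it
is from the complement of their union: a nearest point of the former is a boundary point, hence
not in any of the other sets. -/
theorem infDist_compl_iUnion {E : Type*} [NormedAddCommGroup E] [NormedSpace ℝ E] [ProperSpace E]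
    {ι : Type*} {A : ι → Set E} (hA : ∀ i, IsOpen (A i))
    (hd : Pairwise fun i j => Disjoint (A i) (A j)) (hne : (⋃ i, A i)ᶜ.Nonempty) {i : ι} {x : E}
    (hx : x ∈ A i) : Metric.infDist x (⋃ i, A i)ᶜ = Metric.infDist x (A i)ᶜ := by
  have hsub : (⋃ i, A i)ᶜ ⊆ (A i)ᶜ := Set.compl_subset_compl.2 (Set.subset_iUnion A i)
  refine le_antisymm ?_ (Metric.infDist_le_infDist_of_subset hsub hne)
  obtain ⟨y, hy, hyx⟩ := (hA i).isClosed_compl.exists_infDist_eq_dist (hne.mono hsub) x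
  rw [hyx]
  by_cases hyA : y ∈ ⋃ i, A i
  · exfalso
    obtain ⟨j, hj⟩ := Set.mem_iUnion.1 hyA
    have hij : j ≠ i := fun h => hy (h ▸ hj)
    have hxy : 0 < dist x y := dist_pos.2 fun h => hy (h ▸ hx)
    have hc : Tendsto (fun t : ℝ => AffineMap.lineMap y x t) (𝓝[>] 0) (𝓝 y) := by
      have : Continuous fun t : ℝ => AffineMap.lineMap y x t := AffineMap.lineMap_continuous
      simpa using (this.tendsto 0).mono_left nhdsWithin_le_nhds
    obtain ⟨t, htj, ht⟩ := ((hc.eventually ((hA j).mem_nhds hj)).and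
      (Ioo_mem_nhdsGT (show (0 : ℝ) < 1 by norm_num))).exists
    have h1 := Metric.infDist_le_dist_of_mem (x := x)
      (show AffineMap.lineMap y x t ∈ (A i)ᶜ from fun h => (hd hij).le_bot ⟨htj, h⟩)
    rw [hyx, dist_right_lineMap, Real.norm_eq_abs, abs_of_pos (by linarith [ht.2]),
      dist_comm y x] at h1
    nlinarith [ht.1]
  · exact Metric.infDist_le_dist_of_mem hyA

theorem measurableSet_innerSet {A : Set (EuclideanSpace ℝ (Fin d))} (hA : IsOpen A) (ε : ℝ) :
    MeasurableSet {x | x ∈ A ∧ Metric.infDist x Aᶜ ≤ ε} :=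
  hA.measurableSet.inter
    (isClosed_le (Metric.continuous_infDist_pt _) continuous_const).measurableSet

theorem innerVolume_iUnion {ι : Type*} [Fintype ι] {A : ι → Set (EuclideanSpace ℝ (Fin d))}
    (hA : ∀ i, IsOpen (A i)) (hd : Pairwise fun i j => Disjoint (A i) (A j))
    (hne : (⋃ i, A i)ᶜ.Nonempty) (ε : ℝ) :
    innerVolume (⋃ i, A i) ε = ∑ i, innerVolume (A i) ε := by
  have : {x | x ∈ ⋃ i, A i ∧ Metric.infDist x (⋃ i, A i)ᶜ ≤ ε} =
      ⋃ i, {x | x ∈ A i ∧ Metric.infDist x (A i)ᶜ ≤ ε} := by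
    ext x
    constructor
    · rintro ⟨hx, h⟩
      obtain ⟨i, hi⟩ := Set.mem_iUnion.1 hx
      exact Set.mem_iUnion.2 ⟨i, hi, by rwa [infDist_compl_iUnion hA hd hne hi] at h⟩
    · intro hx
      obtain ⟨i, hi, h⟩ := Set.mem_iUnion.1 hx
      exact ⟨Set.mem_iUnion.2 ⟨i, hi⟩, by rwa [infDist_compl_iUnion hA hd hne hi]⟩
  rw [innerVolume, this, measure_iUnion _ fun i => measurableSet_innerSet (hA i) ε, tsum_fintype]
  · rfl
  · exact fun i j hij => (hd hij).mono (fun x hx => hx.1) fun x hx => hx.1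

theorem innerVolume_mono (A : Set (EuclideanSpace ℝ (Fin d))) {ε ε' : ℝ} (h : ε ≤ ε') :
    innerVolume A ε ≤ innerVolume A ε' :=
  measure_mono fun _ hx => ⟨hx.1, hx.2.trans h⟩

theorem innerVolume_le (A : Set (EuclideanSpace ℝ (Fin d))) (ε : ℝ) :
    innerVolume A ε ≤ volume A :=
  measure_mono fun _ hx => hx.1

theorem compl_nonempty_of_isBounded (hd : 0 < d) {A : Set (EuclideanSpace ℝ (Fin d))}
    (hA : Bornology.IsBounded A) : Aᶜ.Nonempty := by
  have : Nonempty (Fin d) := ⟨⟨0, hd⟩⟩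
  rw [Set.nonempty_compl]
  rintro rfl
  exact NormedSpace.unbounded_univ ℝ (EuclideanSpace ℝ (Fin d)) hA

theorem bddAbove_inradius (hd : 0 < d) {A : Set (EuclideanSpace ℝ (Fin d))}
    (hA : Bornology.IsBounded A) : BddAbove {ρ | 0 < ρ ∧ ∃ x, Metric.ball x ρ ⊆ A} := by
  have : Nonempty (Fin d) := ⟨⟨0, hd⟩⟩
  refine ⟨Metric.diam A, fun ρ hρ => ?_⟩
  obtain ⟨h0, x, hx⟩ := hρ
  have h1 := Metric.diam_mono hx hA
  rw [Metric.diam_ball_eq x h0.le] at h1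
  linarith

theorem inradius_pos (hd : 0 < d) {A : Set (EuclideanSpace ℝ (Fin d))} (hA : IsOpen A)
    (hb : Bornology.IsBounded A) (hne : A.Nonempty) : 0 < inradius A := by
  obtain ⟨x, hx⟩ := hne
  obtain ⟨ρ, h0, hρ⟩ := Metric.isOpen_iff.1 hA x hx
  exact h0.trans_le (le_csSup (bddAbove_inradius hd hb) ⟨h0, x, hρ⟩)

theorem innerVolume_eq_volume (hd : 0 < d) {A : Set (EuclideanSpace ℝ (Fin d))} (hA : IsOpen A)
    (hb : Bornology.IsBounded A) {ε : ℝ} (hε : inradius A ≤ ε) :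
    innerVolume A ε = volume A := by
  rw [innerVolume]
  congr 1
  ext x
  refine ⟨fun h => h.1, fun hx => ⟨hx, le_trans ?_ hε⟩⟩
  have h0 : 0 < Metric.infDist x Aᶜ :=
    (hA.isClosed_compl.notMem_iff_infDist_pos (compl_nonempty_of_isBounded hd hb)).1 (by simpa)
  refine le_csSup (bddAbove_inradius hd hb) ⟨h0, x, fun y hy => ?_⟩
  by_contra hyA
  have := Metric.infDist_le_dist_of_mem (x := x) (show y ∈ Aᶜ from hyA)
  rw [Metric.mem_ball, dist_comm] at hy
  linarith

theorem tendsto_innerVolume_zero (hd : 0 < d) {A : Set (EuclideanSpace ℝ (Fin d))}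
    (hA : IsOpen A) (hb : Bornology.IsBounded A) :
    Tendsto (fun j : ℕ => innerVolume A (1 / ((j : ℝ) + 1))) atTop (𝓝 0) := by
  have h := tendsto_measure_iInter_atTop (μ := volume)
    (s := fun j : ℕ => {x | x ∈ A ∧ Metric.infDist x Aᶜ ≤ 1 / ((j : ℝ) + 1)})
    (fun j => (measurableSet_innerSet hA _).nullMeasurableSet)
    (fun i j hij x hx => ⟨hx.1, hx.2.trans (by gcongr)⟩)
    ⟨0, ((measure_mono fun x hx => hx.1).trans_lt hb.measure_lt_top).ne⟩
  have hempty : ⋂ j : ℕ, {x | x ∈ A ∧ Metric.infDist x Aᶜ ≤ 1 / ((j : ℝ) + 1)} = ∅ := by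
    rw [Set.eq_empty_iff_forall_notMem]
    intro x hx
    rw [Set.mem_iInter] at hx
    have h0 : 0 < Metric.infDist x Aᶜ :=
      (hA.isClosed_compl.notMem_iff_infDist_pos (compl_nonempty_of_isBounded hd hb)).1
        (by simpa using (hx 0).1)
    obtain ⟨j, hj⟩ := exists_nat_one_div_lt h0
    exact absurd (hx j).2 (not_le.2 hj)
  rw [hempty, measure_empty] at h
  exact h

/-- The coefficient of `ε ^ 0` in the inner volume polynomial vanishes. -/
theorem IsMonophaseWith.coeff_top_eq_zero (hd : 0 < d) {G : Set (EuclideanSpace ℝ (Fin d))}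
    {κ : ℕ → ℝ} (hκ : IsMonophaseWith G κ) (hne : G.Nonempty) : κ d = 0 := by
  have hg := inradius_pos hd hκ.isOpen hκ.isBounded hne
  have h1 := (ENNReal.tendsto_toReal ENNReal.zero_ne_top).comp
    (tendsto_innerVolume_zero hd hκ.isOpen hκ.isBounded)
  have hlim := tendsto_one_div_add_atTop_nhds_zero_nat (𝕜 := ℝ)
  have h2 : Tendsto (fun j : ℕ => ∑ k ∈ Finset.range (d + 1),
      κ k * (1 / ((j : ℝ) + 1)) ^ (d - k)) atTop (𝓝 (κ d)) := by
    have hc : Continuous fun ε : ℝ => ∑ k ∈ Finset.range (d + 1), κ k * ε ^ (d - k) := by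
      fun_prop
    have := (hc.tendsto 0).comp hlim
    rw [Finset.sum_range_succ, Finset.sum_eq_zero fun k hk => by
      rw [zero_pow (Nat.sub_ne_zero_of_lt (Finset.mem_range.1 hk)), mul_zero]] at this
    simp only [zero_add, Nat.sub_self, pow_zero, mul_one] at this
    exact this
  refine tendsto_nhds_unique h2 (h1.congr' ?_)
  filter_upwards [(tendsto_order.1 hlim).2 _ hg] with j hj
  exact hκ.volume_eq _ (by positivity) hj.le

theorem IsMonophaseWith.toReal_innerVolume (hd : 0 < d) {G : Set (EuclideanSpace ℝ (Fin d))}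
    {κ : ℕ → ℝ} (hκ : IsMonophaseWith G κ) (hne : G.Nonempty) {ε : ℝ} (hε : 0 < ε)
    (hεg : ε ≤ inradius G) :
    (innerVolume G ε).toReal = ∑ k ∈ Finset.range d, κ k * ε ^ (d - k) := by
  rw [hκ.volume_eq ε hε hεg, Finset.sum_range_succ, hκ.coeff_top_eq_zero hd hne, zero_mul,
    add_zero]

end InnerVolume

/-! ### The self-similar tiling -/

section Tiling

variable {d N : ℕ} {S : Fin N → EuclideanSpace ℝ (Fin d) → EuclideanSpace ℝ (Fin d)}
  {r : Fin N → ℝ} {O G : Set (EuclideanSpace ℝ (Fin d))}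

theorem IsFeasible.dim_pos (hS : IsSelfSimilarSystem S r) (hO : IsFeasible S O) : 0 < d := by
  rw [Nat.pos_iff_ne_zero]
  rintro rfl
  have h2 := hS.two_le
  obtain ⟨x, hx⟩ := hO.nonempty
  refine Set.disjoint_left.1 (hO.disjoint ⟨0, by omega⟩ ⟨1, by omega⟩ (by simp))
    ⟨x, hx, rfl⟩ ⟨x, hx, Subsingleton.elim _ _⟩

theorem generator_subset (hG : generators S O = {G}) : G ⊆ O \ ⋃ n, S n '' closure O := by
  obtain ⟨x, -, h⟩ : G ∈ generators S O := by rw [hG]; rfl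
  rw [h]
  exact connectedComponentIn_subset _ _

theorem generator_nonempty (hG : generators S O = {G}) : G.Nonempty := by
  obtain ⟨x, hx, h⟩ : G ∈ generators S O := by rw [hG]; rfl
  exact ⟨x, h ▸ mem_connectedComponentIn hx⟩

theorem sUnion_tiling (hG : generators S O = {G}) :
    ⋃₀ tiling S O = ⋃ w, wordMap S w '' G := by
  ext x
  simp [tiling, hG]

theorem isOpen_wordMap_image (hS : IsSelfSimilarSystem S r)
    {A : Set (EuclideanSpace ℝ (Fin d))} (hA : IsOpen A) (w : List (Fin N)) :
    IsOpen (wordMap S w '' A) := by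
  induction w with
  | nil => simpa [wordMap]
  | cons n w ih =>
    rw [wordMap, Set.image_comp]
    exact isOpen_image (hS.ratio_pos n) (hS.dist_map n) ih

theorem wordMap_image_subset (hO : IsFeasible S O) (w : List (Fin N)) : wordMap S w '' O ⊆ O := by
  induction w with
  | nil => simp [wordMap]
  | cons n w ih =>
    rw [wordMap, Set.image_comp]
    exact (Set.image_mono ih).trans (hO.image_subset n)

theorem sUnion_tiling_subset (hO : IsFeasible S O) (hG : generators S O = {G}) :
    ⋃₀ tiling S O ⊆ O := by
  rw [sUnion_tiling hG]
  exact Set.iUnion_subset fun w => (Set.image_mono ((generator_subset hG).trans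
    Set.sdiff_subset)).trans (wordMap_image_subset hO w)

theorem isOpen_sUnion_tiling (hS : IsSelfSimilarSystem S r) (hG : generators S O = {G})
    (hGo : IsOpen G) : IsOpen (⋃₀ tiling S O) := by
  rw [sUnion_tiling hG]
  exact isOpen_iUnion fun w => isOpen_wordMap_image hS hGo w

/-- The tiling is bounded: a large enough ball around the origin contains the generator and is
mapped into itself by the contractions. -/
theorem isBounded_sUnion_tiling (hS : IsSelfSimilarSystem S r) (hG : generators S O = {G})
    (hGb : Bornology.IsBounded G) : Bornology.IsBounded (⋃₀ tiling S O) := by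
  obtain ⟨R₀, hR₀⟩ := hGb.subset_closedBall 0
  have h1 : ∀ n, 0 < 1 - r n := fun n => sub_pos.2 (hS.ratio_lt_one n)
  set R := max R₀ (∑ n, ‖S n 0‖ / (1 - r n))
  have hmap : ∀ n, ∀ x ∈ Metric.closedBall 0 R, S n x ∈ Metric.closedBall 0 R := by
    intro n x hx
    have h2 : ‖S n 0‖ / (1 - r n) ≤ R := le_max_of_le_right (Finset.single_le_sum
      (f := fun n => ‖S n 0‖ / (1 - r n)) (fun m _ => div_nonneg (norm_nonneg _) (h1 m).le)
      (Finset.mem_univ n))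
    rw [div_le_iff₀ (h1 n)] at h2
    rw [mem_closedBall_zero_iff] at hx ⊢
    have h3 := hS.dist_map n x 0
    rw [dist_eq_norm, dist_zero_right] at h3
    have h4 := norm_sub_norm_le (S n x) (S n 0)
    nlinarith [hS.ratio_pos n]
  have hword : ∀ w, ∀ x ∈ Metric.closedBall 0 R, wordMap S w x ∈ Metric.closedBall 0 R := by
    intro w
    induction w with
    | nil => exact fun x hx => hx
    | cons n w ih => exact fun x hx => hmap n _ (ih x hx)
  rw [sUnion_tiling hG]
  refine (Metric.isBounded_closedBall (x := 0) (r := R)).subset (Set.iUnion_subset fun w => ?_)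
  rintro _ ⟨x, hx, rfl⟩
  exact hword w x (Metric.closedBall_subset_closedBall (le_max_left _ _) (hR₀ hx))

/-- The tiling consists of the generator and the images of the tiling under the similarities. -/
theorem sUnion_tiling_eq_iUnion_option (hG : generators S O = {G}) :
    ⋃₀ tiling S O = ⋃ o : Option (Fin N), o.elim G fun n => S n '' ⋃₀ tiling S O := by
  rw [sUnion_tiling hG]
  apply subset_antisymm
  · refine Set.iUnion_subset fun w => ?_
    cases w with
    | nil => exact Set.subset_iUnion_of_subset none (by simp [wordMap])
    | cons n w =>
      refine Set.subset_iUnion_of_subset (some n) ?_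
      rw [wordMap, Set.image_comp]
      exact Set.image_mono (Set.subset_iUnion (fun w => wordMap S w '' G) w)
  · refine Set.iUnion_subset fun o => ?_
    cases o with
    | none => exact Set.subset_iUnion_of_subset [] (by simp [wordMap])
    | some n =>
      rw [Option.elim_some, Set.image_iUnion]
      refine Set.iUnion_subset fun w => Set.subset_iUnion_of_subset (n :: w) ?_
      rw [wordMap, Set.image_comp]

theorem innerVolume_tiling (hS : IsSelfSimilarSystem S r) (hO : IsFeasible S O)
    (hG : generators S O = {G}) (hGo : IsOpen G) (hGb : Bornology.IsBounded G) (ε : ℝ) :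
    innerVolume (⋃₀ tiling S O) ε = innerVolume G ε +
      ∑ n, ENNReal.ofReal (r n ^ d) * innerVolume (⋃₀ tiling S O) (ε / r n) := by
  have hne := compl_nonempty_of_isBounded (IsFeasible.dim_pos hS hO)
    (isBounded_sUnion_tiling hS hG hGb)
  have hTO := sUnion_tiling_subset hO hG
  have hGn : ∀ n, Disjoint G (S n '' ⋃₀ tiling S O) := fun n => by
    refine Set.disjoint_left.2 fun x hx hxn => (generator_subset hG hx).2 ?_
    exact Set.mem_iUnion.2 ⟨n, Set.image_mono (hTO.trans subset_closure) hxn⟩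
  have hopen : ∀ o : Option (Fin N), IsOpen (o.elim G fun n => S n '' ⋃₀ tiling S O) := fun o => by
    cases o with
    | none => exact hGo
    | some n =>
      exact isOpen_image (hS.ratio_pos n) (hS.dist_map n) (isOpen_sUnion_tiling hS hG hGo)
  have hdisj : Pairwise fun o o' : Option (Fin N) =>
      Disjoint (o.elim G fun n => S n '' ⋃₀ tiling S O)
        (o'.elim G fun n => S n '' ⋃₀ tiling S O) := by
    intro o o' h
    cases o with
    | none =>
      cases o' with
      | none => exact absurd rfl h
      | some n => exact hGn n
    | some m =>
      cases o' with
      | none => exact (hGn m).symm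
      | some n =>
        have hmn : m ≠ n := fun hmn => h (congrArg some hmn)
        exact (hO.disjoint m n hmn).mono (Set.image_mono hTO) (Set.image_mono hTO)
  have key := innerVolume_iUnion hopen hdisj
    (by rwa [← sUnion_tiling_eq_iUnion_option hG]) ε
  rw [← sUnion_tiling_eq_iUnion_option hG, Fintype.sum_option] at key
  rw [key]
  congr 1
  exact Finset.sum_congr rfl fun n _ => innerVolume_image (hS.ratio_pos n) (hS.dist_map n) _ _

theorem innerVolume_tiling_ne_top (hS : IsSelfSimilarSystem S r)
    (hG : generators S O = {G}) (hGb : Bornology.IsBounded G) (ε : ℝ) :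
    innerVolume (⋃₀ tiling S O) ε ≠ ∞ :=
  ((innerVolume_le _ _).trans_lt
    (isBounded_sUnion_tiling hS hG hGb).measure_lt_top).ne

theorem toReal_innerVolume_tiling (hS : IsSelfSimilarSystem S r) (hO : IsFeasible S O)
    (hG : generators S O = {G}) (hGo : IsOpen G) (hGb : Bornology.IsBounded G) (ε : ℝ) :
    (innerVolume (⋃₀ tiling S O) ε).toReal = (innerVolume G ε).toReal +
      ∑ n, r n ^ d * (innerVolume (⋃₀ tiling S O) (ε / r n)).toReal := by
  have hT := innerVolume_tiling_ne_top hS hG hGb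
  have hG' : innerVolume G ε ≠ ∞ := ((innerVolume_le _ _).trans_lt hGb.measure_lt_top).ne
  have hm : ∀ n ∈ Finset.univ,
      ENNReal.ofReal (r n ^ d) * innerVolume (⋃₀ tiling S O) (ε / r n) ≠ ∞ := fun n _ =>
    ENNReal.mul_ne_top ENNReal.ofReal_ne_top (hT _)
  rw [innerVolume_tiling hS hO hG hGo hGb, ENNReal.toReal_add hG' (ENNReal.sum_ne_top.2 hm),
    ENNReal.toReal_sum hm]
  congr 1
  refine Finset.sum_congr rfl fun n _ => ?_
  rw [ENNReal.toReal_mul, ENNReal.toReal_ofReal (pow_nonneg (hS.ratio_pos n).le d)]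

theorem toReal_innerVolume_generator_pos (hd : 0 < d) (hG : generators S O = {G}) (hGo : IsOpen G)
    (hGb : Bornology.IsBounded G) {ε : ℝ} (hε : inradius G ≤ ε) :
    0 < (innerVolume G ε).toReal := by
  rw [innerVolume_eq_volume hd hGo hGb hε]
  exact ENNReal.toReal_pos (hGo.measure_pos _ (generator_nonempty hG)).ne' hGb.measure_lt_top.ne

theorem toReal_innerVolume_tiling_mono (hS : IsSelfSimilarSystem S r)
    (hG : generators S O = {G}) (hGb : Bornology.IsBounded G) :
    Monotone fun ε => (innerVolume (⋃₀ tiling S O) ε).toReal := fun _ _ h =>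
  ENNReal.toReal_mono (innerVolume_tiling_ne_top hS hG hGb _) (innerVolume_mono _ h)

/-- The open set condition and the existence of a tile of positive volume force `∑ rₙᵈ < 1`. -/
theorem sum_ratio_pow_lt_one (hS : IsSelfSimilarSystem S r) (hO : IsFeasible S O)
    (hG : generators S O = {G}) (hGo : IsOpen G) (hGb : Bornology.IsBounded G) :
    ∑ n, r n ^ d < 1 := by
  have hd := IsFeasible.dim_pos hS hO
  have hT := isBounded_sUnion_tiling hS hG hGb
  have hTo := isOpen_sUnion_tiling hS hG hGo
  set g := max (inradius G) (inradius (⋃₀ tiling S O))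
  have hg0 : 0 < g := lt_max_of_lt_left (inradius_pos hd hGo hGb (generator_nonempty hG))
  have h1 := toReal_innerVolume_tiling hS hO hG hGo hGb g
  have h2 : ∀ n, innerVolume (⋃₀ tiling S O) (g / r n) = volume (⋃₀ tiling S O) := fun n =>
    innerVolume_eq_volume hd hTo hT ((le_max_right _ _).trans
      (by rw [le_div_iff₀ (hS.ratio_pos n)]; nlinarith [hS.ratio_lt_one n]))
  simp only [h2, ← Finset.sum_mul] at h1
  rw [innerVolume_eq_volume hd hTo hT (le_max_right _ _)] at h1
  have h3 := toReal_innerVolume_generator_pos hd hG hGo hGb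
    (show inradius G ≤ g from le_max_left _ _)
  have h4 : 0 ≤ (volume (⋃₀ tiling S O)).toReal := ENNReal.toReal_nonneg
  by_contra! h
  nlinarith

/-- Beyond the inradius of the generator the inner volume of the tiling is its full volume, since
no tile is larger than the generator. -/
theorem innerVolume_tiling_of_inradius_le (hS : IsSelfSimilarSystem S r) (hO : IsFeasible S O)
    (hG : generators S O = {G}) (hGo : IsOpen G) (hGb : Bornology.IsBounded G) {ε : ℝ}
    (hε : inradius G ≤ ε) :
    (innerVolume (⋃₀ tiling S O) ε).toReal = (volume (⋃₀ tiling S O)).toReal := by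
  have hd := IsFeasible.dim_pos hS hO
  have hT := isBounded_sUnion_tiling hS hG hGb
  have hTo := isOpen_sUnion_tiling hS hG hGo
  have hε0 : 0 < ε := (inradius_pos hd hGo hGb (generator_nonempty hG)).trans_le hε
  have hsum := sum_ratio_pow_lt_one hS hO hG hGo hGb
  have hle : ∀ δ, (innerVolume (⋃₀ tiling S O) δ).toReal ≤ (volume (⋃₀ tiling S O)).toReal :=
    fun δ => ENNReal.toReal_mono hT.measure_lt_top.ne (innerVolume_le _ _)
  refine le_antisymm (hle _) ?_
  -- The defect at `ε` is at most `∑ rₙᵈ < 1` times itself.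
  set δ := max ε (inradius (⋃₀ tiling S O))
  have hδ0 : 0 < δ := lt_max_of_lt_left hε0
  have hvol : ∀ δ' ≥ δ, (innerVolume (⋃₀ tiling S O) δ').toReal =
      (volume (⋃₀ tiling S O)).toReal := fun δ' h => by
    rw [innerVolume_eq_volume hd hTo hT ((le_max_right _ _).trans h)]
  have h1 := toReal_innerVolume_tiling hS hO hG hGo hGb ε
  have h2 := toReal_innerVolume_tiling hS hO hG hGo hGb δ
  rw [hvol δ le_rfl, innerVolume_eq_volume hd hGo hGb (hε.trans (le_max_left _ _))] at h2
  rw [innerVolume_eq_volume hd hGo hGb hε] at h1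
  have h3 : ∑ n, r n ^ d * ((volume (⋃₀ tiling S O)).toReal -
      (innerVolume (⋃₀ tiling S O) (ε / r n)).toReal) ≤
      ∑ n, r n ^ d * ((volume (⋃₀ tiling S O)).toReal -
        (innerVolume (⋃₀ tiling S O) ε).toReal) := by
    refine Finset.sum_le_sum fun n _ => mul_le_mul_of_nonneg_left
      (sub_le_sub_left (toReal_innerVolume_tiling_mono hS hG hGb ?_) _)
      (pow_nonneg (hS.ratio_pos n).le d)
    rw [le_div_iff₀ (hS.ratio_pos n)]
    nlinarith [hS.ratio_lt_one n]
  have h4 : ∑ n, r n ^ d * (innerVolume (⋃₀ tiling S O) (δ / r n)).toReal =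
      ∑ n, r n ^ d * (volume (⋃₀ tiling S O)).toReal := by
    refine Finset.sum_congr rfl fun n _ => ?_
    rw [hvol]
    rw [ge_iff_le, le_div_iff₀ (hS.ratio_pos n)]
    nlinarith [hS.ratio_lt_one n]
  rw [← Finset.sum_mul] at h3
  simp only [mul_sub, Finset.sum_sub_distrib] at h3
  rw [h4] at h2
  nlinarith [hle ε]

end Tiling

/-! ### The scaling zeta function -/

section Zeta

variable {N : ℕ} {r : Fin N → ℝ}

theorem wordRatio_pos (hr : ∀ n, 0 < r n) (w : List (Fin N)) : 0 < wordRatio r w := by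
  induction w with
  | nil => simp [wordRatio]
  | cons n w ih =>
    rw [wordRatio, List.map_cons, List.prod_cons]
    exact mul_pos (hr n) ih

theorem wordRatio_rpow (hr : ∀ n, 0 < r n) (σ : ℝ) (w : List (Fin N)) :
    wordRatio r w ^ σ = (w.map fun n => r n ^ σ).prod := by
  induction w with
  | nil => simp [wordRatio]
  | cons n w ih =>
    have h := wordRatio_pos hr w
    rw [wordRatio] at ih h
    rw [wordRatio, List.map_cons, List.prod_cons, Real.mul_rpow (hr n).le h.le, ih,
      List.map_cons, List.prod_cons]

/-- The sum of a multiplicative function over all words is a geometric series. -/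
theorem tsum_list_prod {α : Type*} [Fintype α] (f : α → ℝ≥0∞) :
    ∑' w : List α, (w.map f).prod = (1 - ∑ a, f a)⁻¹ := by
  rw [← List.equivSigmaTuple.symm.tsum_eq, ENNReal.tsum_sigma', ← ENNReal.tsum_geometric]
  congr 1
  ext k
  rw [tsum_fintype, Fintype.sum_pow]
  refine Finset.sum_congr rfl fun v _ => ?_
  simp [List.equivSigmaTuple, List.map_ofFn, List.prod_ofFn]

theorem summable_wordRatio_cpow_iff (hr : ∀ n, 0 < r n) (s : ℂ) :
    (Summable fun w : List (Fin N) => (wordRatio r w : ℂ) ^ s) ↔ ∑ n, r n ^ s.re < 1 := by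
  have h0 : ∀ n, 0 ≤ r n ^ s.re := fun n => Real.rpow_nonneg (hr n).le _
  rw [← summable_norm_iff]
  simp only [Complex.norm_cpow_eq_rpow_re_of_pos (wordRatio_pos hr _)]
  have h1 : ∀ w : List (Fin N), ENNReal.ofReal (wordRatio r w ^ s.re) =
      (w.map fun n => ENNReal.ofReal (r n ^ s.re)).prod := fun w => by
    rw [wordRatio_rpow hr]
    induction w with
    | nil => simp
    | cons n w ih =>
      rw [List.map_cons, List.prod_cons, List.map_cons, List.prod_cons, ← ih,
        ENNReal.ofReal_mul (h0 n)]
  have h2 : (Summable fun w : List (Fin N) => wordRatio r w ^ s.re) ↔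
      ∑' w : List (Fin N), ENNReal.ofReal (wordRatio r w ^ s.re) ≠ ∞ := by
    refine ⟨fun h => h.tsum_ofReal_ne_top, fun h => ?_⟩
    refine (ENNReal.summable_toReal h).congr fun w => ?_
    rw [ENNReal.toReal_ofReal (Real.rpow_nonneg (wordRatio_pos hr w).le _)]
  rw [h2]
  simp only [h1]
  rw [tsum_list_prod, ← ENNReal.ofReal_sum_of_nonneg fun n _ => h0 n, Ne, ENNReal.inv_eq_top,
    tsub_eq_zero_iff_le, not_le, ENNReal.ofReal_lt_one]

theorem strictAnti_sum_rpow (hN : 0 < N) (hr : ∀ n, 0 < r n) (hr1 : ∀ n, r n < 1) :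
    StrictAnti fun σ : ℝ => ∑ n, r n ^ σ := fun σ τ h => by
  have : Nonempty (Fin N) := ⟨⟨0, hN⟩⟩
  exact Finset.sum_lt_sum_of_nonempty Finset.univ_nonempty fun n _ =>
    Real.rpow_lt_rpow_of_exponent_gt (hr n) (hr1 n) h

/-- The abscissa of convergence is the positive solution of the Moran equation. -/
theorem abscissa_spec (hN : 2 ≤ N) (hr : ∀ n, 0 < r n) (hr1 : ∀ n, r n < 1) :
    0 < abscissa r ∧ ∑ n, r n ^ abscissa r = 1 := by
  have hanti := strictAnti_sum_rpow (by omega) hr hr1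
  have hcont : Continuous fun σ : ℝ => ∑ n, r n ^ σ :=
    continuous_finsetSum _ fun n _ => Real.continuous_const_rpow (hr n).ne'
  have hlim : Tendsto (fun σ : ℝ => ∑ n, r n ^ σ) atTop (𝓝 0) := by
    have : (0 : ℝ) = ∑ n : Fin N, 0 := by simp
    rw [this]
    exact tendsto_finsetSum _ fun n _ =>
      tendsto_rpow_atTop_of_base_lt_one _ (by linarith [hr n]) (hr1 n)
  have h0 : (1 : ℝ) < ∑ n, r n ^ (0 : ℝ) := by
    simp only [Real.rpow_zero, Finset.sum_const, Finset.card_univ, Fintype.card_fin, nsmul_eq_mul,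
      mul_one]
    exact_mod_cast hN
  obtain ⟨b, hb, hb0⟩ := (((tendsto_order.1 hlim).2 1 one_pos).and (eventually_ge_atTop 0)).exists
  obtain ⟨D, hD, hDe⟩ := intermediate_value_Icc' hb0 hcont.continuousOn ⟨hb.le, h0.le⟩
  have hDe' : ∑ n, r n ^ D = 1 := hDe
  have hD0 : 0 < D := by
    by_contra! h
    have := hanti.antitone h
    simp only [hDe'] at this
    linarith
  have hset : Complex.re '' {s : ℂ | Summable fun w : List (Fin N) => (wordRatio r w : ℂ) ^ s} =
      Set.Ioi D := by
    ext σ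
    simp only [summable_wordRatio_cpow_iff hr, Set.mem_image, Set.mem_ofPred_eq, Set.mem_Ioi]
    have h1 : ∑ n, r n ^ σ < 1 ↔ D < σ := by
      have := hanti.lt_iff_gt (a := σ) (b := D)
      simpa only [hDe'] using this
    rw [← h1]
    constructor
    · rintro ⟨s, hs, rfl⟩
      exact hs
    · exact fun h => ⟨σ, by simpa using h, by simp⟩
  have : abscissa r = D := by rw [abscissa, hset, csInf_Ioi]
  rw [this]
  exact ⟨hD0, hDe'⟩

end Zeta

/-! ### The renewal equation of the tiling -/

section TilingRenewal

variable {d N : ℕ} {S : Fin N → EuclideanSpace ℝ (Fin d) → EuclideanSpace ℝ (Fin d)}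
  {r : Fin N → ℝ} {O G : Set (EuclideanSpace ℝ (Fin d))} {κ : ℕ → ℝ} {D : ℝ}

/-- The rescaled inner volume `ε ^ (-(d - α)) V(A, ε)` of a set at `ε = e ^ (-t)`. -/
noncomputable def scaledVolume (A : Set (EuclideanSpace ℝ (Fin d))) (α t : ℝ) : ℝ :=
  Real.exp ((d - α) * t) * (innerVolume A (Real.exp (-t))).toReal

theorem scaledVolume_nonneg (A : Set (EuclideanSpace ℝ (Fin d))) (α t : ℝ) :
    0 ≤ scaledVolume A α t := mul_nonneg (Real.exp_pos _).le ENNReal.toReal_nonneg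

theorem scaledVolume_eq_mul (A : Set (EuclideanSpace ℝ (Fin d))) (α β t : ℝ) :
    scaledVolume A α t = Real.exp ((β - α) * t) * scaledVolume A β t := by
  rw [scaledVolume, scaledVolume, ← mul_assoc, ← Real.exp_add]
  ring_nf

theorem exp_neg_mul_log_inv {x : ℝ} (hx : 0 < x) (s : ℝ) :
    Real.exp (-s * Real.log x⁻¹) = x ^ s := by
  rw [Real.log_inv, Real.rpow_def_of_pos hx]
  ring_nf

theorem lt_dim (hS : IsSelfSimilarSystem S r) (hO : IsFeasible S O) (hG : generators S O = {G})
    (hκ : IsMonophaseWith G κ) (hD : ∑ n, r n ^ D = 1) : D < d := by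
  have h := sum_ratio_pow_lt_one hS hO hG hκ.isOpen hκ.isBounded
  by_contra! hle
  have h1 := (strictAnti_sum_rpow (by have := hS.two_le; omega) hS.ratio_pos
    hS.ratio_lt_one).antitone hle
  simp only [hD, Real.rpow_natCast] at h1
  linarith

/-- The scaled volume of the tiling solves a renewal equation with weights `rₙ ^ D` and steps
`log rₙ⁻¹`, in which the generator acts as the inhomogeneity. -/
theorem isExpSolution_tiling (hS : IsSelfSimilarSystem S r) (hO : IsFeasible S O)
    (hG : generators S O = {G}) (hκ : IsMonophaseWith G κ) (hD : ∑ n, r n ^ D = 1)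
    (hdD : (d : ℝ) - 1 < D) :
    Renewal.IsExpSolution (fun n => r n ^ D) (fun n => Real.log (r n)⁻¹)
      (scaledVolume (⋃₀ tiling S O) D) d κ (fun k => D - k) (d - D)
      (volume (⋃₀ tiling S O)).toReal (-Real.log (inradius G)) := by
  have hd := IsFeasible.dim_pos hS hO
  have hGo := hκ.isOpen
  have hGb := hκ.isBounded
  have hGne := generator_nonempty hG
  have hg := inradius_pos hd hGo hGb hGne
  have hDd := lt_dim hS hO hG hκ hD
  have hmono := toReal_innerVolume_tiling_mono hS hG hGb
  have hsource : ∀ t ≥ -Real.log (inradius G),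
      ∑ k ∈ Finset.range d, κ k * Real.exp (-(D - k) * t) =
        Real.exp ((d - D) * t) * (innerVolume G (Real.exp (-t))).toReal := fun t ht => by
    have h1 : Real.exp (-t) ≤ inradius G := by
      rw [← Real.exp_log hg]
      gcongr
      linarith
    rw [hκ.toReal_innerVolume hd hGne (Real.exp_pos _) h1, Finset.mul_sum]
    refine Finset.sum_congr rfl fun k hk => ?_
    rw [← Real.exp_nat_mul, Nat.cast_sub (Finset.mem_range.1 hk).le, mul_left_comm,
      ← Real.exp_add]
    ring_nf
  refine ⟨fun n => Real.rpow_pos_of_pos (hS.ratio_pos n) D, hD, fun n => ?_, fun k hk => ?_,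
    by linarith, ?_, scaledVolume_nonneg _ _, fun t s hs => ?_, fun x y => ?_, fun t ht => ?_,
    fun t ht => ?_, fun t ht => ?_⟩
  · exact Real.log_pos ((one_lt_inv₀ (hS.ratio_pos n)).2 (hS.ratio_lt_one n))
  · have : (k : ℝ) + 1 ≤ d := by exact_mod_cast hk
    change 0 < D - k
    linarith
  · have hsub : G ⊆ ⋃₀ tiling S O := by
      rw [sUnion_tiling hG]
      exact Set.subset_iUnion_of_subset [] (by simp [wordMap])
    exact ENNReal.toReal_pos
      ((isOpen_sUnion_tiling hS hG hGo).measure_pos _ (hGne.mono hsub)).ne'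
      (isBounded_sUnion_tiling hS hG hGb).measure_lt_top.ne
  · rw [scaledVolume, scaledVolume, ← mul_assoc, ← Real.exp_add, mul_add, add_comm]
    exact mul_le_mul_of_nonneg_left (hmono (Real.exp_le_exp.2 (by linarith))) (Real.exp_pos _).le
  · have hanti : Antitone fun t => (innerVolume (⋃₀ tiling S O) (Real.exp (-t))).toReal :=
      fun s t h => hmono (by gcongr)
    exact hanti.intervalIntegrable.continuousOn_mul (by fun_prop)
  · rw [scaledVolume, innerVolume_tiling_of_inradius_le hS hO hG hGo hGb, mul_comm]
    rw [← Real.exp_log hg]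
    gcongr
    linarith
  · rw [hsource t ht, scaledVolume, toReal_innerVolume_tiling hS hO hG hGo hGb, mul_add,
      add_sub_assoc, add_eq_left, sub_eq_zero, Finset.mul_sum]
    refine Finset.sum_congr rfl fun n _ => ?_
    have hr := hS.ratio_pos n
    have h1 : Real.exp (-(t - Real.log (r n)⁻¹)) = Real.exp (-t) / r n := by
      rw [neg_sub, sub_eq_add_neg, Real.exp_add, Real.exp_log (inv_pos.2 hr)]
      field_simp
    have h2 : Real.exp ((d - D) * (t - Real.log (r n)⁻¹)) =
        Real.exp ((d - D) * t) * r n ^ (d - D) := by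
      rw [← exp_neg_mul_log_inv hr, ← Real.exp_add]
      ring_nf
    have h3 : r n ^ D * r n ^ (d - D) = r n ^ d := by
      rw [← Real.rpow_add hr, add_sub_cancel, Real.rpow_natCast]
    rw [scaledVolume, h1, h2, ← h3]
    ring
  · rw [hsource t ht]
    exact mul_nonneg (Real.exp_pos _).le ENNReal.toReal_nonneg

theorem sourceMass_tiling (hS : IsSelfSimilarSystem S r) (hO : IsFeasible S O)
    (hG : generators S O = {G}) (hκ : IsMonophaseWith G κ) (hD : ∑ n, r n ^ D = 1)
    (hdD : (d : ℝ) - 1 < D) :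
    Renewal.sourceMass d κ (fun k => D - k) (d - D)
      ((volume (⋃₀ tiling S O)).toReal *
        (1 - ∑ n, r n ^ D * Real.exp (-(d - D) * Real.log (r n)⁻¹)))
      (-Real.log (inradius G)) = Gam G κ D / (d - D) := by
  have hd := IsFeasible.dim_pos hS hO
  have hGo := hκ.isOpen
  have hGb := hκ.isBounded
  have hGne := generator_nonempty hG
  have hg := inradius_pos hd hGo hGb hGne
  have hDd := lt_dim hS hO hG hκ hD
  have hlam : (volume (⋃₀ tiling S O)).toReal *
      (1 - ∑ n, r n ^ D * Real.exp (-(d - D) * Real.log (r n)⁻¹)) =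
      ∑ k ∈ Finset.range d, κ k * inradius G ^ (d - k) := by
    have h1 : ∑ n, r n ^ D * Real.exp (-(d - D) * Real.log (r n)⁻¹) = ∑ n, r n ^ d :=
      Finset.sum_congr rfl fun n _ => by
        rw [exp_neg_mul_log_inv (hS.ratio_pos n), ← Real.rpow_add (hS.ratio_pos n),
          add_sub_cancel, Real.rpow_natCast]
    have h2 := toReal_innerVolume_tiling hS hO hG hGo hGb (inradius G)
    have h3 : ∀ n, (innerVolume (⋃₀ tiling S O) (inradius G / r n)).toReal =
        (volume (⋃₀ tiling S O)).toReal := fun n =>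
      innerVolume_tiling_of_inradius_le hS hO hG hGo hGb (by
        rw [le_div_iff₀ (hS.ratio_pos n)]
        nlinarith [hS.ratio_lt_one n])
    simp only [h3, ← Finset.sum_mul] at h2
    rw [innerVolume_tiling_of_inradius_le hS hO hG hGo hGb le_rfl,
      hκ.toReal_innerVolume hd hGne hg le_rfl] at h2
    rw [h1]
    linarith
  have hexp : ∀ c : ℝ, Real.exp (c * -Real.log (inradius G)) = inradius G ^ (-c) := fun c => by
    rw [Real.rpow_def_of_pos hg]
    ring_nf
  rw [Renewal.sourceMass, hlam, hexp, Finset.sum_mul, Finset.sum_div, ← Finset.sum_add_distrib,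
    Gam, Finset.sum_div]
  refine Finset.sum_congr rfl fun k hk => ?_
  have hk' : (k : ℝ) + 1 ≤ d := by exact_mod_cast Finset.mem_range.1 hk
  have h1 : inradius G ^ (d - k) * inradius G ^ (-((d : ℝ) - D)) = inradius G ^ (D - k) := by
    rw [← Real.rpow_natCast, Nat.cast_sub (Finset.mem_range.1 hk).le, ← Real.rpow_add hg]
    ring_nf
  rw [hexp, neg_neg, mul_assoc, h1]
  have h2 : D - k ≠ 0 := by linarith
  have h3 : (d : ℝ) - D ≠ 0 := by linarith
  field_simp
  ring

theorem hasMinkowskiContent_iff {𝒯 : Set (Set (EuclideanSpace ℝ (Fin d)))}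
    (h𝒯 : ∀ ε, innerVolume (⋃₀ 𝒯) ε ≠ ∞) {α : ℝ} {L : ℝ≥0∞} :
    HasMinkowskiContent 𝒯 α L ↔
      Tendsto (fun t => ENNReal.ofReal (scaledVolume (⋃₀ 𝒯) α t)) atTop (𝓝 L) := by
  have hexp : Tendsto (fun t : ℝ => Real.exp (-t)) atTop (𝓝[>] 0) :=
    tendsto_nhdsWithin_iff.2 ⟨Real.tendsto_exp_neg_atTop_nhds_zero,
      Eventually.of_forall fun t => Real.exp_pos _⟩
  have hlog : Tendsto (fun ε : ℝ => -Real.log ε) (𝓝[>] 0) atTop :=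
    tendsto_neg_atBot_atTop.comp Real.tendsto_log_nhdsGT_zero
  have heq : ∀ t, ENNReal.ofReal (Real.exp (-t) ^ (-((d : ℝ) - α))) *
      innerVolume (⋃₀ 𝒯) (Real.exp (-t)) = ENNReal.ofReal (scaledVolume (⋃₀ 𝒯) α t) := fun t => by
    rw [scaledVolume, ENNReal.ofReal_mul (Real.exp_pos _).le, ENNReal.ofReal_toReal (h𝒯 _),
      ← Real.exp_mul]
    ring_nf
  constructor
  · intro h
    exact (h.comp hexp).congr heq
  · intro h
    refine (h.comp hlog).congr' ?_
    filter_upwards [self_mem_nhdsWithin] with ε hε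
    rw [Function.comp_apply, ← heq, neg_neg, Real.exp_log hε]

theorem image_exp_neg_Ico {b : ℝ} (hb : 0 < b) :
    (fun t : ℝ => Real.exp (-t)) '' Set.Ico 0 (Real.log b) = Set.Ioc (1 / b) 1 := by
  ext ε
  constructor
  · rintro ⟨t, ⟨h0, h1⟩, rfl⟩
    refine ⟨?_, Real.exp_le_one_iff.2 (by linarith)⟩
    change 1 / b < Real.exp (-t)
    rw [one_div, ← Real.exp_log (inv_pos.2 hb), Real.log_inv]
    gcongr
  · rintro ⟨h0, h1⟩
    have hε : 0 < ε := (by positivity : 0 < 1 / b).trans h0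
    refine ⟨-Real.log ε, ⟨by linarith [Real.log_nonpos hε.le h1], ?_⟩, ?_⟩
    · have := Real.log_lt_log (by positivity) h0
      rw [one_div, Real.log_inv] at this
      linarith
    · simp [Real.exp_log hε]

theorem hasAverageMinkowskiContent_iff {𝒯 : Set (Set (EuclideanSpace ℝ (Fin d)))}
    (h𝒯 : ∀ ε, innerVolume (⋃₀ 𝒯) ε ≠ ∞) {α : ℝ} {L : ℝ≥0∞}
    (hint : ∀ x y, IntervalIntegrable (scaledVolume (⋃₀ 𝒯) α) volume x y) :
    HasAverageMinkowskiContent 𝒯 α L ↔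
      Tendsto (fun b => ENNReal.ofReal
        ((∫ t in (0 : ℝ)..Real.log b, scaledVolume (⋃₀ 𝒯) α t) / Real.log b)) atTop (𝓝 L) := by
  refine tendsto_congr' ?_
  filter_upwards [eventually_gt_atTop 1] with b hb
  have hlog := Real.log_pos hb
  rw [ENNReal.ofReal_div_of_pos hlog]
  congr 1
  have hderiv : ∀ t ∈ Set.Ico 0 (Real.log b), HasDerivWithinAt (fun t : ℝ => Real.exp (-t))
      (-Real.exp (-t)) (Set.Ico 0 (Real.log b)) t := fun t _ => by
    simpa using (hasDerivAt_neg t).exp.hasDerivWithinAt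
  have hinj : Set.InjOn (fun t : ℝ => Real.exp (-t)) (Set.Ico 0 (Real.log b)) := fun s _ t _ h => by
    simpa using h
  rw [← image_exp_neg_Ico (by linarith),
    lintegral_image_eq_lintegral_abs_deriv_mul measurableSet_Ico hderiv hinj,
    intervalIntegral.integral_of_le hlog.le, ← integral_Ico_eq_integral_Ioc,
    ofReal_integral_eq_lintegral_ofReal]
  · refine lintegral_congr fun t => ?_
    rw [abs_neg, abs_of_pos (Real.exp_pos _), ← mul_assoc,
      ← ENNReal.ofReal_mul (Real.exp_pos _).le, scaledVolume,
      ENNReal.ofReal_mul (p := Real.exp ((d - α) * t)) (Real.exp_pos _).le,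
      ENNReal.ofReal_toReal (h𝒯 _), mul_div_cancel₀ _ (Real.exp_pos _).ne', ← Real.exp_mul]
    ring_nf
  · exact ((intervalIntegrable_iff_integrableOn_Ico_of_le hlog.le).1 (hint _ _))
  · exact Eventually.of_forall fun t => scaledVolume_nonneg _ _ _

/-- Steps generating a cyclic group mean that all ratios are powers of one number. -/
theorem dense_closure_of_not_isLattice (hr : ∀ n, 0 < r n) (h : ¬ IsLattice r) :
    Dense (AddSubgroup.closure (Set.range fun n => Real.log (r n)⁻¹) : Set ℝ) := by
  refine (AddSubgroup.dense_or_cyclic _).resolve_right ?_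
  rintro ⟨a, ha⟩
  have hk : ∀ n, ∃ k : ℤ, k • a = Real.log (r n)⁻¹ := fun n => by
    rw [← AddSubgroup.mem_closure_singleton, ← ha]
    exact AddSubgroup.subset_closure ⟨n, rfl⟩
  choose k hk using hk
  refine h ⟨Real.exp (-a), Real.exp_pos _, k, fun n => ?_⟩
  rw [← Real.rpow_intCast, ← Real.exp_mul, ← Real.exp_log (hr n)]
  have := hk n
  rw [Real.log_inv, zsmul_eq_mul] at this
  congr 1
  linarith

end TilingRenewal

end SelfSimilarTiling

/-! ### Minkowski content and measurability -/

open SelfSimilarTiling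

theorem theorem4p8 {d N : ℕ}
    (S : Fin N → EuclideanSpace ℝ (Fin d) → EuclideanSpace ℝ (Fin d)) (r : Fin N → ℝ)
    (hS : SelfSimilarTiling.IsSelfSimilarSystem S r)
    (O : Set (EuclideanSpace ℝ (Fin d))) (hO : SelfSimilarTiling.IsFeasible S O)
    (G : Set (EuclideanSpace ℝ (Fin d))) (hG : SelfSimilarTiling.generators S O = {G})
    (κ : ℕ → ℝ) (hκ : SelfSimilarTiling.IsMonophaseWith G κ)
    (D : ℝ) (hD : D = SelfSimilarTiling.abscissa r) (hdD : (d : ℝ) - 1 < D) :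
    SelfSimilarTiling.minkowskiDim (SelfSimilarTiling.tiling S O) = D ∧
    (SelfSimilarTiling.IsMinkowskiMeasurable (SelfSimilarTiling.tiling S O) ↔
      ¬ SelfSimilarTiling.IsLattice r) ∧
    (¬ SelfSimilarTiling.IsLattice r →
      ∃ c : ℝ, c = SelfSimilarTiling.Gam G κ D /
          (((d : ℝ) - D) * ∑ n, r n ^ D * Real.log (r n)⁻¹) ∧
        0 < c ∧
        SelfSimilarTiling.HasMinkowskiContent (SelfSimilarTiling.tiling S O) D
          (ENNReal.ofReal c)) ∧
    (∀ (ρ : ℝ) (k : Fin N → ℤ), 0 < ρ → (∀ n, r n = ρ ^ k n) →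
      (¬ ∃ L : ENNReal,
        SelfSimilarTiling.HasMinkowskiContent (SelfSimilarTiling.tiling S O) D L) ∧
      ∃ c : ℝ, c = SelfSimilarTiling.Gam G κ D /
          (((d : ℝ) - D) * ∑ n, ρ ^ ((k n : ℝ) * D) * (k n : ℝ) * Real.log ρ⁻¹) ∧
        0 < c ∧
        SelfSimilarTiling.HasAverageMinkowskiContent (SelfSimilarTiling.tiling S O) D
          (ENNReal.ofReal c)) := by
  obtain ⟨hD0, hDsum⟩ := abscissa_spec hS.two_le hS.ratio_pos hS.ratio_lt_one
  rw [← hD] at hD0 hDsum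
  have H := isExpSolution_tiling hS hO hG hκ hDsum hdD
  have hmass := sourceMass_tiling hS hO hG hκ hDsum hdD
  have hDd := lt_dim hS hO hG hκ hDsum
  have hfin := innerVolume_tiling_ne_top hS hG hκ.isBounded
  set Z := scaledVolume (⋃₀ tiling S O) D with hZ
  set μ := ∑ n, r n ^ D * Real.log (r n)⁻¹ with hμ
  set c := Gam G κ D / (((d : ℝ) - D) * μ) with hc
  have hcdiv : c = Gam G κ D / (d - D) / μ := by rw [hc, div_div]
  have hNe := H.index_nonempty
  have hμ0 : 0 < μ :=
    Finset.sum_pos (fun n _ => mul_pos (H.weight_pos n) (H.step_pos n)) Finset.univ_nonempty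
  have hc0 : 0 < c := by
    rw [hcdiv, ← hmass]
    exact div_pos H.sourceMass_pos hμ0
  have havg : Tendsto (fun x => (∫ t in (0 : ℝ)..x, Z t) / x) atTop (𝓝 c) := by
    rw [hcdiv, ← hmass]
    exact H.tendsto_average
  obtain ⟨B, hB⟩ := H.exists_bound
  have hZB : ∀ t, Z t ≤ B := fun t => (abs_le.1 (hB t)).2
  have hZ0 : ∀ t, 0 ≤ Z t := H.nonneg
  -- A limit of `Z` is also the limit of its averages.
  have hlim : ∀ L, Tendsto Z atTop (𝓝 L) → L = c := fun L hL =>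
    tendsto_nhds_unique (Renewal.tendsto_integral_div_of_tendsto H.intervalIntegrable hL) havg
  have hreal : ∀ {α : ℝ} {L : ℝ≥0∞}, L ≠ ∞ → HasMinkowskiContent (tiling S O) α L →
      Tendsto (fun t => Real.exp ((D - α) * t) * Z t) atTop (𝓝 L.toReal) := by
    intro α L hL h
    refine ((ENNReal.tendsto_toReal hL).comp ((hasMinkowskiContent_iff hfin).1 h)).congr
      fun t => ?_
    rw [Function.comp_apply, ENNReal.toReal_ofReal (scaledVolume_nonneg _ _ _),
      scaledVolume_eq_mul _ α D]
  have hgt : ∀ α > D, HasMinkowskiContent (tiling S O) α 0 := by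
    intro α hα
    rw [hasMinkowskiContent_iff hfin]
    have h1 : Tendsto (fun t => Real.exp ((D - α) * t) * B) atTop (𝓝 (0 * B)) :=
      (Real.tendsto_exp_atBot.comp
        (tendsto_id.const_mul_atTop_of_neg (by linarith))).mul_const B
    rw [zero_mul] at h1
    have h2 := squeeze_zero (fun t => scaledVolume_nonneg (⋃₀ tiling S O) α t) (fun t => by
      rw [scaledVolume_eq_mul _ α D]
      exact mul_le_mul_of_nonneg_left (hZB t) (Real.exp_pos _).le) h1
    simpa using ENNReal.tendsto_ofReal h2
  have hle : ∀ α ≤ D, ¬ HasMinkowskiContent (tiling S O) α 0 := by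
    intro α hα h
    have h1 := hreal ENNReal.zero_ne_top h
    rw [ENNReal.toReal_zero] at h1
    refine hc0.ne (hlim 0 (squeeze_zero' (Eventually.of_forall hZ0) ?_ h1))
    filter_upwards [eventually_ge_atTop 0] with t ht
    exact le_mul_of_one_le_left (hZ0 t)
      (Real.one_le_exp (mul_nonneg (sub_nonneg.2 hα) ht))
  have hnonlat : ¬ IsLattice r → HasMinkowskiContent (tiling S O) D (ENNReal.ofReal c) := by
    intro h
    rw [hasMinkowskiContent_iff hfin]
    refine ENNReal.tendsto_ofReal ?_
    rw [hcdiv, ← hmass]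
    exact H.tendsto_of_dense (dense_closure_of_not_isLattice hS.ratio_pos h)
  have hlog : ∀ (ρ : ℝ) (k : Fin N → ℤ), (∀ n, r n = ρ ^ k n) →
      ∀ n, Real.log (r n)⁻¹ = k n * Real.log ρ⁻¹ := fun ρ k hk n => by
    rw [hk, Real.log_inv, Real.log_inv, Real.log_zpow]
    ring
  have hlat : ∀ (ρ : ℝ) (k : Fin N → ℤ), (∀ n, r n = ρ ^ k n) →
      ¬ ∃ L : ℝ≥0∞, HasMinkowskiContent (tiling S O) D L := by
    rintro ρ k hk ⟨L, hL⟩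
    have hLB : L ≤ ENNReal.ofReal B :=
      le_of_tendsto' ((hasMinkowskiContent_iff hfin).1 hL)
        fun t => ENNReal.ofReal_le_ofReal (hZB t)
    have h1 := hreal (hLB.trans_lt ENNReal.ofReal_lt_top).ne hL
    simp only [sub_self, zero_mul, Real.exp_zero, one_mul] at h1
    have hne : Real.log ρ⁻¹ ≠ 0 := fun h0 => by
      obtain ⟨n⟩ := hNe
      have := H.step_pos n
      simp only [hlog ρ k hk n, h0, mul_zero, lt_self_iff_false] at this
    refine H.not_tendsto_of_lattice (abs_pos.2 hne) (m := fun n => (k n).natAbs)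
      (fun n => ?_) _ h1
    rw [← abs_of_pos (H.step_pos n), hlog ρ k hk n, abs_mul, Nat.cast_natAbs, Int.cast_abs]
  refine ⟨?_, ⟨?_, fun h => ⟨D, hD0.le, hDd.le, _, ENNReal.ofReal_pos.2 hc0,
    ENNReal.ofReal_lt_top, hnonlat h⟩⟩, fun h => ⟨c, rfl, hc0, hnonlat h⟩,
    fun ρ k hρ hk => ⟨hlat ρ k hk, c, ?_, hc0, ?_⟩⟩
  · have : {α : ℝ | 0 ≤ α ∧ HasMinkowskiContent (tiling S O) α 0} = Set.Ioi D := by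
      ext α
      refine ⟨fun h => ?_, fun h => ⟨(hD0.trans h).le, hgt α h⟩⟩
      by_contra hα
      exact hle α (not_lt.1 hα) h.2
    rw [minkowskiDim, this, csInf_Ioi]
  · rintro ⟨α, -, -, L, hL0, hL1, hL⟩ ⟨ρ, hρ, k, hk⟩
    rcases lt_trichotomy α D with hα | rfl | hα
    · have h1 : Tendsto (fun t => Real.exp (-((D - α) * t))) atTop (𝓝 0) :=
        Real.tendsto_exp_neg_atTop_nhds_zero.comp
          (tendsto_id.const_mul_atTop (sub_pos.2 hα))
      have h2 := h1.mul (hreal hL1.ne hL)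
      rw [zero_mul] at h2
      refine hc0.ne (hlim 0 (h2.congr fun t => ?_))
      rw [← mul_assoc, ← Real.exp_add, neg_add_cancel, Real.exp_zero, one_mul]
    · exact hlat ρ k hk ⟨L, hL⟩
    · exact hL0.ne (tendsto_nhds_unique (hgt α hα) hL)
  · rw [hc, hμ]
    congr 2
    refine Finset.sum_congr rfl fun n _ => ?_
    rw [hlog ρ k hk n, hk n, Real.rpow_mul hρ.le, Real.rpow_intCast, mul_assoc]
  · rw [hasAverageMinkowskiContent_iff hfin H.intervalIntegrable]
    exact ENNReal.tendsto_ofReal (havg.comp Real.tendsto_log_atTop)
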